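/- Let $M$ be an oriented smooth surface with boundary and corners (for instance a closed disc), with a finite smooth triangulation $\mathcal T$: finitely many closed triangles $T$ cover $M$, each is the image of the standard simplex $\hat T$ under an orientation-preserving diffeomorphism, and two different triangles meet in a common proper face or not at all. A Regge metric $g$ on $(M,\mathcal T)$ consists of a Riemannian metric on each closed triangle, smooth up to its boundary, such that the metrics induced on a common edge by the two triangles containing it agree. For a Regge metric $g$ and a triangle $T$ let $K$ be the Gauss curvature and $dA$ the area form on $T$; let $n$ be the outward unit normal along an edge of $T$, $\tau$ the unit tangent in the orientation of $\partial T$, $ds$ the arclength, $k=-\langle\nabla_\tau\tau,n\rangle$ the geodesic curvature, and $\theta_T(p)$ the interior angle of $T$ at its vertex $p$; all are measured by $g|_T$. For an edge $e$, $[[k\,ds]]$ is the sum of $k\,ds$ over the (one or two) triangles that contain $e$, and $dv([[n]])$ is the sum of $d(v|_T)(n)$ over these triangles. Let $e_1$ be a unit vector field along the edges of $\partial M$ and let $\mu$ be the angle from $e_1$ to the outward normal, $e_1=\cos\mu\,n-\sin\mu\,\tau$, given by a real-valued $C^1$ branch on each boundary edge. At a boundary vertex $p$ let $[[\mu]]|_p$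 be the value of $\mu$ at $p$ on the boundary edge that starts at $p$ minus the value on the boundary edge that ends at $p$, in the boundary orientation. For $v:M\to\mathbb R$ put \[ \langle\langle KdA_{\mathrm{dist}}(g),v\rangle\rangle=\sum_{T}\int_T vK\,dA+\sum_{e\not\subset\partial M}\int_e v[[k\,ds]]+\sum_{p\notin\partial M}v(p)\Bigl(2\pi-\sum_{T\ni p}\theta_T(p)\Bigr), \] \[ \langle\langle\alpha_{\mathrm{dist}}(g),v\rangle\rangle=\sum_{e\subset\partial M}\int_e v(d\mu-k\,ds)-\sum_{p\in\partial M}v(p)\Bigl(\pi-[[\mu]]|_p-\sum_{T\ni p}\theta_T(p)\Bigr), \] \[ b_h(g;\sigma,v)=\sum_{T}\int_T\langle\mathbb S\sigma,\nabla\nabla v\rangle\,dA-\sum_{e}\int_e(\mathbb S\sigma)(n,n)\,dv([[n]])\,ds,\qquad \mathbb S\sigma=\sigma-\mathrm{tr}_g(\sigma)\,g, \] where $T$, $e$, $p$ run over the triangles, edges and vertices of $\mathcal T$, and $\sigma$ is a symmetric bilinear form on each triangle whose tangential-tangential components agree on common edges (so that $(\mathbb S\sigma)(n,n)=-\sigma(\tau,\tau)$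 is the same from both sides of an edge). Theorem. Let $v:M\to\mathbb R$ be such that $v|_T\in C^2(T)$ for every closed triangle $T$, and let $g(t)$, $t\in[0,1]$, be a family of Regge metrics on $(M,\mathcal T)$ such that on each closed triangle $T$ the metric $g(t)|_T$ depends smoothly on $t$ (its coefficients are smooth in $(t,x)\in[0,1]\times T$). Suppose that the unit field $e_1(t)$ along $\partial M$ evolves so that its angle $\mu$ with the outward normal, measured by $g(t)$, does not depend on $t$. Then, for every $t\in[0,1]$ (with one-sided derivatives at $0$ and $1$), the derivative below exists and \[ \frac{\partial}{\partial t}\Bigl[\langle\langle\alpha_{\mathrm{dist}}(g(t)),v\rangle\rangle-\langle\langle KdA_{\mathrm{dist}}(g(t)),v\rangle\rangle\Bigr]=-\frac12\,b_h(g(t);\dot g(t),v). \] -/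

import Mathlib

open scoped Manifold ContDiff Matrix

noncomputable section

namespace Regge

/-! ### The reference triangle -/

/-- Coordinates on the reference triangle. -/
abbrev Coord : Type := Fin 2 → ℝ

/-- The standard closed `2`-simplex. -/
def refTriangle : Set Coord := {x | 0 ≤ x 0 ∧ 0 ≤ x 1 ∧ x 0 + x 1 ≤ 1}

/-- Its vertices, in counterclockwise order. -/
def refVertex : Fin 3 → Coord := ![![0, 0], ![1, 0], ![0, 1]]

/-- Its faces: the face spanned by a set of vertices (`∅` spans the empty set). -/
def refFace (s : Finset (Fin 3)) : Set Coord := convexHull ℝ (refVertex '' (s : Set (Fin 3)))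

/-- The direction of the `k`-th side, which runs from vertex `k` to vertex `k + 1`. -/
def sideDir (k : Fin 3) : Coord := refVertex (k + 1) - refVertex k

/-- The counterclockwise parametrization of the `k`-th side by `s ∈ [0,1]`. -/
def sidePt (k : Fin 3) (s : ℝ) : Coord := refVertex k + s • sideDir k

/-- The covector that annihilates the `k`-th side and is positive on outward vectors
(the direction of the side, rotated clockwise by a right angle). -/
def sideConormal (k : Fin 3) : Coord := ![sideDir k 1, -sideDir k 0]

/-! ### Riemannian geometry on the reference triangle

`G` is the matrix of a Riemannian metric in the coordinates of the reference triangle, and `w` is a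
function in these coordinates. All derivatives are taken within the closed triangle, hence are
one-sided on its boundary. -/

/-- A field of bilinear forms in coordinates. -/
abbrev MatField : Type := Coord → Matrix (Fin 2) (Fin 2) ℝ

/-- The partial derivative `∂_a w`. -/
def partialD (a : Fin 2) (w : Coord → ℝ) (x : Coord) : ℝ :=
  fderivWithin ℝ w refTriangle x (Pi.single a 1)

/-- The value of a bilinear form with matrix `A` on two vectors. -/
def form (A : Matrix (Fin 2) (Fin 2) ℝ) (u w : Coord) : ℝ := u ⬝ᵥ (A *ᵥ w)

/-- The Christoffel symbol `Γ^c_{ab}` of the Levi-Civita connection. -/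
def christoffel (G : MatField) (c a b : Fin 2) (x : Coord) : ℝ :=
  (1 / 2) * ∑ d, (G x)⁻¹ c d *
    (partialD a (fun y => G y b d) x + partialD b (fun y => G y a d) x
      - partialD d (fun y => G y a b) x)

/-- The curvature coefficients: `R(∂_a, ∂_b) ∂_c = ∑_d R^d_{cab} ∂_d`, with
`R(X, Y) = ∇_X ∇_Y - ∇_Y ∇_X - ∇_{[X, Y]}`. -/
def riemann (G : MatField) (d c a b : Fin 2) (x : Coord) : ℝ :=
  partialD a (christoffel G d b c) x - partialD b (christoffel G d a c) x
    + ∑ e, (christoffel G d a e x * christoffel G e b c x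
      - christoffel G d b e x * christoffel G e a c x)

/-- The Gauss curvature `⟨R(∂₀, ∂₁) ∂₁, ∂₀⟩ / det G`. -/
def gaussCurv (G : MatField) (x : Coord) : ℝ :=
  (∑ d, G x 0 d * riemann G d 1 0 1 x) / (G x).det

/-- The density of the area form `dA` with respect to Lebesgue measure. -/
def areaDensity (G : MatField) (x : Coord) : ℝ := √(G x).det

/-- The covariant Hessian `∇∇w`. -/
def hessian (G : MatField) (w : Coord → ℝ) (x : Coord) : Matrix (Fin 2) (Fin 2) ℝ :=
  Matrix.of fun a b =>
    partialD a (partialD b w) x - ∑ c, christoffel G c a b x * partialD c w x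

/-- The inner product that the metric induces on bilinear forms,
`⟨A, B⟩ = G^{ac} G^{bd} A_{ab} B_{cd}`. -/
def tensorInner (Gx A B : Matrix (Fin 2) (Fin 2) ℝ) : ℝ :=
  ∑ a, ∑ b, ∑ c, ∑ d, Gx⁻¹ a c * Gx⁻¹ b d * A a b * B c d

/-- The metric trace `G^{ab} A_{ab}`. -/
def metricTrace (Gx A : Matrix (Fin 2) (Fin 2) ℝ) : ℝ := ∑ a, ∑ b, Gx⁻¹ a b * A a b

/-- `𝕊σ = σ - tr(σ) g`. -/
def opS (Gx A : Matrix (Fin 2) (Fin 2) ℝ) : Matrix (Fin 2) (Fin 2) ℝ :=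
  A - metricTrace Gx A • Gx

/-- The length of the velocity of `sidePt k` at the point with metric matrix `Gx`; the length
element of the side is `ds = sideSpeed ds'` with `s'` the parameter. -/
def sideSpeed (Gx : Matrix (Fin 2) (Fin 2) ℝ) (k : Fin 3) : ℝ :=
  √(form Gx (sideDir k) (sideDir k))

/-- The unit tangent `τ` of the `k`-th side, in counterclockwise direction. -/
def unitTangent (Gx : Matrix (Fin 2) (Fin 2) ℝ) (k : Fin 3) : Coord :=
  (sideSpeed Gx k)⁻¹ • sideDir k

/-- The outward unit normal `n` of the `k`-th side: the normalization of the outward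
conormal with its index raised by the metric. -/
def unitNormal (Gx : Matrix (Fin 2) (Fin 2) ℝ) (k : Fin 3) : Coord :=
  (√(form Gx⁻¹ (sideConormal k) (sideConormal k)))⁻¹ • (Gx⁻¹ *ᵥ sideConormal k)

/-- The geodesic curvature of the `k`-th side at a point `x` of it, as part of the boundary of the
triangle: `⟨∇_{γ'} γ', -n⟩ / |γ'|²` for `γ = sidePt k`, whose coordinate acceleration vanishes.
It is positive where the triangle is convex. -/
def geodCurv (G : MatField) (k : Fin 3) (x : Coord) : ℝ :=
  form (G x) (fun c => ∑ a, ∑ b, christoffel G c a b x * sideDir k a * sideDir k b)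
    (-unitNormal (G x) k) / sideSpeed (G x) k ^ 2

/-- The interior angle at vertex `k`, between the outgoing side `k` and the reversed
incoming side `k - 1` (that is, `k + 2`). -/
def interiorAngle (G : MatField) (k : Fin 3) : ℝ :=
  Real.arccos (form (G (refVertex k)) (unitTangent (G (refVertex k)) k)
    (-unitTangent (G (refVertex k)) (k + 2)))

/-! ### Oriented surfaces with corners and their triangulations -/

/-- The model of surfaces with boundary and corners: the quadrant in the plane. -/
abbrev modelI : ModelWithCorners ℝ (EuclideanSpace ℝ (Fin 2)) (EuclideanQuadrant 2) :=
  modelWithCornersEuclideanQuadrant 2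

variable {M : Type*} [TopologicalSpace M] [ChartedSpace (EuclideanQuadrant 2) M]

/-- The determinant of two tangent vectors in the preferred chart at the point. -/
def tangentDet (x : M) (u w : TangentSpace modelI x) : ℝ :=
  let u' : EuclideanSpace ℝ (Fin 2) := u
  let w' : EuclideanSpace ℝ (Fin 2) := w
  u' 0 * w' 1 - u' 1 * w' 0

variable (M) in
/-- An orientation of a surface: `sign x` tells whether the preferred chart at `x` is positively or
negatively oriented at `x`, and these choices are locally consistent. -/
structure SurfaceOrientation [IsManifold modelI ∞ M] where
  sign : M → ℤˣ
  consistent : ∀ x₀ : M, ∀ᶠ x in nhds x₀,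
    0 < ((sign x : ℤ) : ℝ) * ((sign x₀ : ℤ) : ℝ) *
      (tangentCoordChange modelI x x₀ x).toLinearMap.det

/-- The differential of a map from the reference triangle to the surface. -/
def diffMap (f : Coord → M) (x : Coord) :
    TangentSpace 𝓘(ℝ, Coord) x →L[ℝ] TangentSpace modelI (f x) :=
  mfderivWithin 𝓘(ℝ, Coord) modelI f refTriangle x

/-- A finite smooth triangulation of an oriented surface. Each triangle is given with an
orientation-preserving diffeomorphism `param i` from the reference triangle onto it; the edges and
vertices are those of the triangles. -/
structure Triangulation [IsManifold modelI ∞ M] (o : SurfaceOrientation M)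
    (ι : Type*) [Fintype ι] where
  param : ι → Coord → M
  smooth : ∀ i, ContMDiffOn 𝓘(ℝ, Coord) modelI ∞ (param i) refTriangle
  injOn : ∀ i, Set.InjOn (param i) refTriangle
  orientation_preserving : ∀ i, ∀ x ∈ refTriangle,
    0 < ((o.sign (param i x) : ℤ) : ℝ) *
      tangentDet (param i x) (diffMap (param i) x (Pi.single 0 1 : Coord))
        (diffMap (param i) x (Pi.single 1 1 : Coord))
  cover : ⋃ i, param i '' refTriangle = Set.univ
  /-- Two different triangles meet in a common proper face, possibly empty. -/
  inter : ∀ i j, i ≠ j → ∃ s s' : Finset (Fin 3), s ≠ Finset.univ ∧ s' ≠ Finset.univ ∧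
    param i '' refTriangle ∩ param j '' refTriangle = param i '' refFace s ∧
    param i '' refFace s = param j '' refFace s'

namespace Triangulation

variable [IsManifold modelI ∞ M] {o : SurfaceOrientation M} {ι : Type*} [Fintype ι]
variable (𝒯 : Triangulation o ι)

/-- The `k`-th edge of the `i`-th triangle, as a subset of the surface. -/
def edge (i : ι) (k : Fin 3) : Set M := 𝒯.param i '' (sidePt k '' Set.Icc 0 1)

/-- The `k`-th vertex of the `i`-th triangle. -/
def vertex (i : ι) (k : Fin 3) : M := 𝒯.param i (refVertex k)

open Classical in
/-- The edges of the triangulation. -/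
def edges : Finset (Set M) := Finset.univ.image fun q : ι × Fin 3 => 𝒯.edge q.1 q.2

open Classical in
/-- The vertices of the triangulation. -/
def vertices : Finset M := Finset.univ.image fun q : ι × Fin 3 => 𝒯.vertex q.1 q.2

open Classical in
/-- The sum of `X` over the triangles that contain the edge `e`: a sum of two terms for an interior
edge and of one term for a boundary edge. With `X i k` an integral over the `k`-th edge of
triangle `i` in the orientation induced by that triangle, or with an integrand that depends on its
outward normal, this is the integral over `e` of the jump. -/
def edgeSum (X : ι → Fin 3 → ℝ) (e : Set M) : ℝ :=
  ∑ i, ∑ k, if 𝒯.edge i k = e then X i k else 0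

open Classical in
/-- The sum of `X` over the triangles that contain the vertex `p`. -/
def vertexSum (X : ι → Fin 3 → ℝ) (p : M) : ℝ :=
  ∑ i, ∑ k, if 𝒯.vertex i k = p then X i k else 0

/-- The edge lies in the boundary of the surface. -/
def IsBoundarySide (i : ι) (k : Fin 3) : Prop := 𝒯.edge i k ⊆ ModelWithCorners.boundary (I := modelI) M

/-! ### Regge metrics -/

variable (M ι) in
/-- For each triangle a field of functions of two tangent vectors (a bilinear form in all uses). -/
abbrev PiecewiseForm : Type _ :=
  ι → (x : M) → TangentSpace modelI x → TangentSpace modelI x → ℝ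

/-- The matrix of the `i`-th field in the coordinates of the `i`-th triangle. -/
def matrixOf (σ : PiecewiseForm M ι) (i : ι) : MatField := fun x => Matrix.of fun a b =>
  σ i (𝒯.param i x) (diffMap (𝒯.param i) x (Pi.single a 1 : Coord))
    (diffMap (𝒯.param i) x (Pi.single b 1 : Coord))

/-- A Regge metric: a smooth Riemannian metric on each closed triangle, such that the metrics
that two triangles induce on a common edge agree. -/
structure ReggeMetric where
  form : ι → (x : M) → TangentSpace modelI x →ₗ[ℝ] TangentSpace modelI x →ₗ[ℝ] ℝ
  symm : ∀ i, ∀ x ∈ 𝒯.param i '' refTriangle, ∀ u w, form i x u w = form i x w u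
  pos : ∀ i, ∀ x ∈ 𝒯.param i '' refTriangle, ∀ u, u ≠ 0 → 0 < form i x u u
  smooth : ∀ i a b, ContDiffOn ℝ ∞
    (fun x => 𝒯.matrixOf (fun j y u w => form j y u w) i x a b) refTriangle
  compat : ∀ i j k l, 𝒯.edge i k = 𝒯.edge j l → ∀ s ∈ Set.Icc (0 : ℝ) 1,
    form i (𝒯.param i (sidePt k s)) (diffMap (𝒯.param i) (sidePt k s) (sideDir k))
        (diffMap (𝒯.param i) (sidePt k s) (sideDir k))
      = form j (𝒯.param i (sidePt k s)) (diffMap (𝒯.param i) (sidePt k s) (sideDir k))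
        (diffMap (𝒯.param i) (sidePt k s) (sideDir k))

variable {𝒯}

/-- The matrix of the metric in the coordinates of the `i`-th triangle. -/
def ReggeMetric.mat (g : 𝒯.ReggeMetric) (i : ι) : MatField :=
  𝒯.matrixOf (fun j y u w => g.form j y u w) i

/-- The family `g t`, `t ∈ [0,1]`, is smooth on each triangle: its coefficients are smooth functions
of the parameter and the point, up to the boundary. -/
def SmoothFamily (g : ℝ → 𝒯.ReggeMetric) : Prop :=
  ∀ i a b, ContDiffOn ℝ ∞ (fun q : ℝ × Coord => (g q.1).mat i q.2 a b)
    (Set.Icc 0 1 ×ˢ refTriangle)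

/-- The derivative of the family with respect to the parameter (one-sided at `0` and `1`). -/
def familyDeriv (g : ℝ → 𝒯.ReggeMetric) (t : ℝ) : PiecewiseForm M ι :=
  fun i x u w => derivWithin (fun s => (g s).form i x u w) (Set.Icc 0 1) t

variable (𝒯)

/-- `v` is of class `C²` on each closed triangle. -/
def PiecewiseC2 (v : M → ℝ) : Prop :=
  ∀ i, ContDiffOn ℝ 2 (v ∘ 𝒯.param i) refTriangle

variable {𝒯}

/-- `μ` is the angle that the unit vector field `e₁` makes with the outward normal along the
boundary, measured by `g`: on the `k`-th edge of triangle `i`, if it is a boundary edge, `μ i k` is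
a branch of the oriented angle from `e₁` to the outward unit normal `n`, that is
`e₁ = cos μ n - sin μ τ` for the positively oriented orthonormal frame `(n, τ)`. -/
def IsBoundaryAngle (g : 𝒯.ReggeMetric)
    (e₁ : (i : ι) → (k : Fin 3) → (s : ℝ) → TangentSpace modelI (𝒯.param i (sidePt k s)))
    (μ : ι → Fin 3 → ℝ → ℝ) : Prop :=
  ∀ i k, 𝒯.IsBoundarySide i k → ∀ s ∈ Set.Icc (0 : ℝ) 1,
    e₁ i k s = diffMap (𝒯.param i) (sidePt k s)
      (Real.cos (μ i k s) • unitNormal (g.mat i (sidePt k s)) k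
        - Real.sin (μ i k s) • unitTangent (g.mat i (sidePt k s)) k : Coord)

/-- `∫_e v k ds` over the `k`-th edge of triangle `i`, with the geodesic curvature of that edge in
the boundary of that triangle. -/
def curvIntegral (g : 𝒯.ReggeMetric) (v : M → ℝ) (i : ι) (k : Fin 3) : ℝ :=
  ∫ s in (0 : ℝ)..1, v (𝒯.param i (sidePt k s)) * geodCurv (g.mat i) k (sidePt k s) *
    sideSpeed (g.mat i (sidePt k s)) k

/-- `∑_{T ∋ p} θ_T(p)`. -/
def angleSum (g : 𝒯.ReggeMetric) (p : M) : ℝ :=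
  𝒯.vertexSum (fun i k => interiorAngle (g.mat i) k) p

open Classical in
/-- The distributional Gaussian curvature `⟨⟨KdA_dist(g), v⟩⟩`. -/
def curvDist (g : 𝒯.ReggeMetric) (v : M → ℝ) : ℝ :=
  (∑ i, ∫ x in refTriangle,
      v (𝒯.param i x) * gaussCurv (g.mat i) x * areaDensity (g.mat i) x)
    + (∑ e ∈ 𝒯.edges with ¬ e ⊆ ModelWithCorners.boundary (I := modelI) M,
        𝒯.edgeSum (curvIntegral g v) e)
    + ∑ p ∈ 𝒯.vertices with p ∉ ModelWithCorners.boundary (I := modelI) M,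
        v p * (2 * Real.pi - angleSum g p)

variable (𝒯) in
open Classical in
/-- The jump `[[μ]]|_p` at a boundary vertex: the value at `p` on the boundary edge that starts
there minus the value on the boundary edge that ends there, in the boundary orientation. -/
def angleJump (μ : ι → Fin 3 → ℝ → ℝ) (p : M) : ℝ :=
  (∑ i, ∑ k, if 𝒯.IsBoundarySide i k ∧ 𝒯.vertex i k = p then μ i k 0 else 0)
    - ∑ i, ∑ k, if 𝒯.IsBoundarySide i k ∧ 𝒯.vertex i (k + 1) = p then μ i k 1 else 0

open Classical in
/-- The distributional boundary connection term `⟨⟨α_dist(g), v⟩⟩` with boundary angle `μ`. -/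
def connDist (g : 𝒯.ReggeMetric) (μ : ι → Fin 3 → ℝ → ℝ) (v : M → ℝ) : ℝ :=
  (∑ e ∈ 𝒯.edges with e ⊆ ModelWithCorners.boundary (I := modelI) M,
      𝒯.edgeSum (fun i k =>
        (∫ s in (0 : ℝ)..1, v (𝒯.param i (sidePt k s)) * derivWithin (μ i k) (Set.Icc 0 1) s)
          - curvIntegral g v i k) e)
    - ∑ p ∈ 𝒯.vertices with p ∈ ModelWithCorners.boundary (I := modelI) M,
        v p * (Real.pi - 𝒯.angleJump μ p - angleSum g p)

/-- `∫_e (𝕊σ)(n,n) dv(n) ds` over the `k`-th edge of triangle `i`, with `n` the outward unit normal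
of that triangle. -/
def normalIntegral (g : 𝒯.ReggeMetric) (σ : PiecewiseForm M ι) (v : M → ℝ) (i : ι) (k : Fin 3) :
    ℝ :=
  ∫ s in (0 : ℝ)..1,
    form (opS (g.mat i (sidePt k s)) (𝒯.matrixOf σ i (sidePt k s)))
        (unitNormal (g.mat i (sidePt k s)) k) (unitNormal (g.mat i (sidePt k s)) k) *
      fderivWithin ℝ (v ∘ 𝒯.param i) refTriangle (sidePt k s)
        (unitNormal (g.mat i (sidePt k s)) k) *
      sideSpeed (g.mat i (sidePt k s)) k

/-- The form `b_h(g; σ, v)`. In the edge terms `(𝕊σ)(n,n) = -σ(τ,τ)` takes the same value from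
both sides of an edge, for `σ` with continuous tangential-tangential components, so
`(𝕊σ)(n,n) dv([[n]])` is the sum over the triangles at the edge of `(𝕊σ)(n,n) dv(n)` with `n` the
outward normal of the triangle. -/
def bForm (g : 𝒯.ReggeMetric) (σ : PiecewiseForm M ι) (v : M → ℝ) : ℝ :=
  (∑ i, ∫ x in refTriangle,
      tensorInner (g.mat i x) (opS (g.mat i x) (𝒯.matrixOf σ i x))
          (hessian (g.mat i) (v ∘ 𝒯.param i) x) * areaDensity (g.mat i) x)
    - ∑ e ∈ 𝒯.edges, 𝒯.edgeSum (normalIntegral g σ v) e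

end Triangulation

end Regge

end

open scoped Manifold ContDiff Matrix

noncomputable section

namespace Regge

open Set MeasureTheory

/-! ### The reference triangle: topology and integration -/

/-! The statement is local: it is a variation formula on each triangle, summed. In `connDist -
curvDist` the geodesic curvatures enter with a minus sign and the interior angles with a plus sign,
on interior and boundary edges and vertices alike. Since the boundary angle is fixed, the difference
is a quantity free of the metric minus the sum over triangles of ∫ w K dA + Σ ∫ w k ds - Σ w θ, with
w the test function in the coordinates of the triangle (`connDist_sub_curvDist`). It remains to show
that the time derivative of this expression is half the contribution of the triangle to b_h
(`hasDerivWithinAt_triangleCurv`).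

On one triangle, fix a constant direction d and let (e, Je) be the positive orthonormal frame with e
= d/|d|. Its connection form ω = ⟨∇e, Je⟩ (`conn`) satisfies K dA = -dω, and if d is the direction
of a side then ω restricts to k ds on that side. For σ = ∂_t g the key identity is ∂_t ω = *J + dρ,
where *J has components (J₁, -J₀). Here J (`flux`) is the covariant divergence of the density S = ½
(𝕊σ) √det g (`stress`) and does not depend on d, while ρ = -½ σ(n, τ) (`rotRate`) does; n is τ = e
turned clockwise. See `time_conn_zero` and `time_conn_one`. Consequently K dA varies by div J,
because the exact part is closed; k ds varies by minus the flux of J through the side plus the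
derivative of ρ along it; and an interior angle varies by the difference of the ρ of its two sides
(`hasDerivWithinAt_interiorAngle`).

Testing with w, two integrations by parts turn ∫ w div J into ∫ S : ∇∇w plus boundary terms. The
fluxes of J cancel against those from k ds. Integrating w ∂_τ ρ along the sides gives endpoint
values, which cancel against the angles, and -ρ ∂_τ w, which removes the tangential part of S(n,
dw). What is left on the sides is -½ (𝕊σ)(n,n) dw(n) ds (`form_opS_unitNormal`). -/

theorem convex_refTriangle : Convex ℝ refTriangle := by
  rintro x ⟨h0, h1, h2⟩ y ⟨k0, k1, k2⟩ a b ha hb hab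
  refine ⟨?_, ?_, ?_⟩ <;> simp only [Pi.add_apply, Pi.smul_apply, smul_eq_mul]
  · positivity
  · positivity
  · nlinarith

theorem isClosed_refTriangle : IsClosed refTriangle := by
  have h0 : IsClosed {x : Coord | 0 ≤ x 0} := isClosed_le (by fun_prop) (by fun_prop)
  have h1 : IsClosed {x : Coord | 0 ≤ x 1} := isClosed_le (by fun_prop) (by fun_prop)
  have h2 : IsClosed {x : Coord | x 0 + x 1 ≤ 1} := isClosed_le (by fun_prop) (by fun_prop)
  exact h0.inter (h1.inter h2)

theorem isCompact_refTriangle : IsCompact refTriangle := by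
  refine (isCompact_Icc (a := (0 : Coord)) (b := 1)).of_isClosed_subset isClosed_refTriangle ?_
  rintro x ⟨h0, h1, h2⟩
  refine ⟨fun i => ?_, fun i => ?_⟩ <;> fin_cases i <;> simp <;> linarith

theorem measurableSet_refTriangle : MeasurableSet refTriangle :=
  isClosed_refTriangle.measurableSet

theorem interior_refTriangle_nonempty : (interior refTriangle).Nonempty := by
  refine ⟨![1 / 4, 1 / 4], mem_interior.2
    ⟨{x | 0 < x 0 ∧ 0 < x 1 ∧ x 0 + x 1 < 1}, ?_, ?_, ?_⟩⟩
  · rintro x ⟨h0, h1, h2⟩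
    exact ⟨h0.le, h1.le, h2.le⟩
  · have h0 : IsOpen {x : Coord | 0 < x 0} := isOpen_lt (by fun_prop) (by fun_prop)
    have h1 : IsOpen {x : Coord | 0 < x 1} := isOpen_lt (by fun_prop) (by fun_prop)
    have h2 : IsOpen {x : Coord | x 0 + x 1 < 1} := isOpen_lt (by fun_prop) (by fun_prop)
    exact h0.inter (h1.inter h2)
  · norm_num

theorem uniqueDiffOn_refTriangle : UniqueDiffOn ℝ refTriangle :=
  uniqueDiffOn_convex convex_refTriangle interior_refTriangle_nonempty

theorem refVertex_mem (k : Fin 3) : refVertex k ∈ refTriangle := by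
  fin_cases k <;> simp [refVertex, refTriangle]

theorem sidePt_eq (k : Fin 3) (s : ℝ) :
    sidePt k s = (1 - s) • refVertex k + s • refVertex (k + 1) := by
  simp only [sidePt, sideDir]
  module

theorem sidePt_mem (k : Fin 3) {s : ℝ} (hs : s ∈ Icc (0 : ℝ) 1) : sidePt k s ∈ refTriangle := by
  rw [sidePt_eq]
  exact convex_refTriangle (refVertex_mem k) (refVertex_mem (k + 1)) (by linarith [hs.2]) hs.1
    (by ring)

theorem sidePt_zero (k : Fin 3) : sidePt k 0 = refVertex k := by simp [sidePt]

theorem sidePt_one (k : Fin 3) : sidePt k 1 = refVertex (k + 1) := by simp [sidePt, sideDir]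

theorem hasDerivAt_sidePt (k : Fin 3) (s : ℝ) : HasDerivAt (sidePt k) (sideDir k) s := by
  have := ((hasDerivAt_id s).smul_const (sideDir k)).const_add (refVertex k)
  rwa [one_smul] at this

theorem continuous_sidePt (k : Fin 3) : Continuous (sidePt k) :=
  continuous_iff_continuousAt.2 fun s => (hasDerivAt_sidePt k s).continuousAt

/-! ### Iterated integrals and the divergence theorem on the triangle. -/

theorem mem_refTriangle_vec {a b : ℝ} :
    (![a, b] : Coord) ∈ refTriangle ↔ 0 ≤ a ∧ 0 ≤ b ∧ a + b ≤ 1 := by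
  simp [refTriangle]

/-- Extension by zero to the whole plane makes Fubini available in either order, so that each
partial derivative can be integrated along its own coordinate. -/
theorem integral_refTriangle_eq_prod (f : Coord → ℝ) :
    ∫ x in refTriangle, f x
      = ∫ p : ℝ × ℝ, refTriangle.indicator f ![p.1, p.2] := by
  rw [← integral_indicator measurableSet_refTriangle]
  exact (((volume_preserving_finTwoArrow ℝ).symm _).integral_comp' _).symm

theorem integrable_indicator_prod {f : Coord → ℝ} (hf : ContinuousOn f refTriangle) :
    Integrable (fun p : ℝ × ℝ => refTriangle.indicator f ![p.1, p.2]) := by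
  have h : Integrable (refTriangle.indicator f) :=
    (integrable_indicator_iff measurableSet_refTriangle).2
      (hf.integrableOn_compact isCompact_refTriangle)
  exact ((volume_preserving_finTwoArrow ℝ).symm _).integrable_comp_of_integrable h

theorem integral_slice_fst (f : Coord → ℝ) (b : ℝ) :
    ∫ a, refTriangle.indicator f ![a, b]
      = (Icc (0 : ℝ) 1).indicator (fun b => ∫ a in (0 : ℝ)..(1 - b), f ![a, b]) b := by
  by_cases hb : b ∈ Icc (0 : ℝ) 1
  · rw [indicator_of_mem hb, intervalIntegral.integral_of_le (by linarith [hb.2]),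
      ← integral_Icc_eq_integral_Ioc, ← integral_indicator measurableSet_Icc]
    congr 1
    ext a
    by_cases ha : a ∈ Icc (0 : ℝ) (1 - b)
    · rw [indicator_of_mem ha, indicator_of_mem]
      exact mem_refTriangle_vec.2 ⟨ha.1, hb.1, by linarith [ha.2]⟩
    · rw [indicator_of_notMem ha, indicator_of_notMem]
      intro h
      obtain ⟨h0, h1, h2⟩ := mem_refTriangle_vec.1 h
      exact ha ⟨h0, by linarith⟩
  · rw [indicator_of_notMem hb]
    have : ∀ a : ℝ, refTriangle.indicator f ![a, b] = 0 := by
      intro a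
      rw [indicator_of_notMem]
      intro h
      obtain ⟨h0, h1, h2⟩ := mem_refTriangle_vec.1 h
      exact hb ⟨h1, by linarith⟩
    simp [this]

theorem integral_slice_snd (f : Coord → ℝ) (a : ℝ) :
    ∫ b, refTriangle.indicator f ![a, b]
      = (Icc (0 : ℝ) 1).indicator (fun a => ∫ b in (0 : ℝ)..(1 - a), f ![a, b]) a := by
  by_cases ha : a ∈ Icc (0 : ℝ) 1
  · rw [indicator_of_mem ha, intervalIntegral.integral_of_le (by linarith [ha.2]),
      ← integral_Icc_eq_integral_Ioc, ← integral_indicator measurableSet_Icc]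
    congr 1
    ext b
    by_cases hb : b ∈ Icc (0 : ℝ) (1 - a)
    · rw [indicator_of_mem hb, indicator_of_mem]
      exact mem_refTriangle_vec.2 ⟨ha.1, hb.1, by linarith [hb.2]⟩
    · rw [indicator_of_notMem hb, indicator_of_notMem]
      intro h
      obtain ⟨h0, h1, h2⟩ := mem_refTriangle_vec.1 h
      exact hb ⟨h1, by linarith⟩
  · rw [indicator_of_notMem ha]
    have : ∀ b : ℝ, refTriangle.indicator f ![a, b] = 0 := by
      intro b
      rw [indicator_of_notMem]
      intro h
      obtain ⟨h0, h1, h2⟩ := mem_refTriangle_vec.1 h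
      exact ha ⟨h0, by linarith⟩
    simp [this]

theorem integral_refTriangle_fst {f : Coord → ℝ} (hf : ContinuousOn f refTriangle) :
    ∫ x in refTriangle, f x = ∫ b in (0 : ℝ)..1, ∫ a in (0 : ℝ)..(1 - b), f ![a, b] := by
  rw [integral_refTriangle_eq_prod, Measure.volume_eq_prod, integral_prod_symm]
  · simp only [integral_slice_fst]
    rw [integral_indicator measurableSet_Icc, integral_Icc_eq_integral_Ioc,
      intervalIntegral.integral_of_le zero_le_one]
  · exact integrable_indicator_prod hf

theorem integral_refTriangle_snd {f : Coord → ℝ} (hf : ContinuousOn f refTriangle) :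
    ∫ x in refTriangle, f x = ∫ a in (0 : ℝ)..1, ∫ b in (0 : ℝ)..(1 - a), f ![a, b] := by
  rw [integral_refTriangle_eq_prod, Measure.volume_eq_prod, integral_prod]
  · simp only [integral_slice_snd]
    rw [integral_indicator measurableSet_Icc, integral_Icc_eq_integral_Ioc,
      intervalIntegral.integral_of_le zero_le_one]
  · exact integrable_indicator_prod hf

theorem continuousOn_partialD {f : Coord → ℝ} (hf : ContDiffOn ℝ 1 f refTriangle)
    (a : Fin 2) : ContinuousOn (partialD a f) refTriangle :=
  (hf.continuousOn_fderivWithin uniqueDiffOn_refTriangle le_rfl).clm_apply continuousOn_const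

/-- The fundamental theorem of calculus along a segment in the triangle. -/
theorem integral_partialD_segment {f : Coord → ℝ} (hf : ContDiffOn ℝ 1 f refTriangle)
    {l : ℝ} (hl : 0 ≤ l) {c : ℝ → Coord} {a : Fin 2}
    (hc : ∀ s, HasDerivAt c (Pi.single a 1) s) (hmem : MapsTo c (Icc 0 l) refTriangle) :
    ∫ s in (0 : ℝ)..l, partialD a f (c s) = f (c l) - f (c 0) := by
  have hcc : Continuous c := continuous_iff_continuousAt.2 fun s => (hc s).continuousAt
  refine intervalIntegral.integral_eq_sub_of_hasDerivAt_of_le hl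
    (hf.continuousOn.comp hcc.continuousOn hmem) (fun s hs => ?_) ?_
  · have h1 : HasFDerivWithinAt f (fderivWithin ℝ f refTriangle (c s)) refTriangle (c s) :=
      (hf.differentiableOn one_ne_zero _ (hmem (Ioo_subset_Icc_self hs))).hasFDerivWithinAt
    have h2 := h1.comp_hasDerivWithinAt s ((hc s).hasDerivWithinAt (s := Icc 0 l)) hmem
    exact h2.hasDerivAt (Icc_mem_nhds hs.1 hs.2)
  · refine ContinuousOn.intervalIntegrable_of_Icc hl ?_
    exact (continuousOn_partialD hf a).comp hcc.continuousOn hmem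

theorem hasDerivAt_vec_fst (b s : ℝ) :
    HasDerivAt (fun a : ℝ => (![a, b] : Coord)) (Pi.single 0 1) s := by
  rw [hasDerivAt_pi]
  intro i
  fin_cases i
  · simpa using hasDerivAt_id' s
  · simpa using hasDerivAt_const s b

theorem hasDerivAt_vec_snd (a s : ℝ) :
    HasDerivAt (fun b : ℝ => (![a, b] : Coord)) (Pi.single 1 1) s := by
  rw [hasDerivAt_pi]
  intro i
  fin_cases i
  · simpa using hasDerivAt_const s a
  · simpa using hasDerivAt_id' s

theorem integral_partialD_zero {f : Coord → ℝ} (hf : ContDiffOn ℝ 1 f refTriangle) :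
    ∫ x in refTriangle, partialD 0 f x
      = ∫ b in (0 : ℝ)..1, (f ![1 - b, b] - f ![0, b]) := by
  rw [integral_refTriangle_fst (continuousOn_partialD hf 0)]
  refine intervalIntegral.integral_congr fun b hb => ?_
  rw [uIcc_of_le zero_le_one] at hb
  refine integral_partialD_segment hf (by linarith [hb.2]) (hasDerivAt_vec_fst b) fun a ha => ?_
  exact mem_refTriangle_vec.2 ⟨ha.1, hb.1, by linarith [ha.2]⟩

theorem integral_partialD_one {f : Coord → ℝ} (hf : ContDiffOn ℝ 1 f refTriangle) :
    ∫ x in refTriangle, partialD 1 f x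
      = ∫ a in (0 : ℝ)..1, (f ![a, 1 - a] - f ![a, 0]) := by
  rw [integral_refTriangle_snd (continuousOn_partialD hf 1)]
  refine intervalIntegral.integral_congr fun a ha => ?_
  rw [uIcc_of_le zero_le_one] at ha
  refine integral_partialD_segment hf (by linarith [ha.2]) (hasDerivAt_vec_snd a) fun b hb => ?_
  exact mem_refTriangle_vec.2 ⟨ha.1, hb.1, by linarith [hb.2]⟩

theorem sidePt_zero_eq (s : ℝ) : sidePt 0 s = ![s, 0] := by
  ext i; fin_cases i <;> simp [sidePt, sideDir, refVertex]

theorem sidePt_one_eq (s : ℝ) : sidePt 1 s = ![1 - s, s] := by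
  ext i; fin_cases i <;> simp [sidePt, sideDir, refVertex]; ring

theorem sidePt_two_eq (s : ℝ) : sidePt 2 s = ![0, 1 - s] := by
  ext i; fin_cases i <;> simp [sidePt, sideDir, refVertex]; ring

theorem sideDir_eq : sideDir = ![![1, 0], ![-1, 1], ![0, -1]] := by
  ext k i; fin_cases k <;> fin_cases i <;> simp [sideDir, refVertex]

theorem sideConormal_eq : sideConormal = ![![0, -1], ![1, 1], ![-1, 0]] := by
  ext k i; fin_cases k <;> fin_cases i <;> simp [sideConormal, sideDir_eq]

/-- The divergence theorem on the reference triangle. -/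
theorem integral_divergence_refTriangle {f : Fin 2 → Coord → ℝ}
    (hf : ∀ a, ContDiffOn ℝ 1 (f a) refTriangle) :
    ∫ x in refTriangle, (partialD 0 (f 0) x + partialD 1 (f 1) x)
      = ∑ k, ∫ s in (0 : ℝ)..1, (f 0 (sidePt k s) * sideConormal k 0
          + f 1 (sidePt k s) * sideConormal k 1) := by
  have hint : ∀ a (k : Fin 3),
      IntervalIntegrable (fun s => f a (sidePt k s)) volume 0 1 := by
    intro a k
    refine ContinuousOn.intervalIntegrable_of_Icc zero_le_one ?_
    exact (hf a).continuousOn.comp (continuous_sidePt k).continuousOn fun s hs => sidePt_mem k hs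
  have hi00 := hint 0 0
  have hi01 := hint 0 1
  have hi02 := hint 0 2
  have hi10 := hint 1 0
  have hi11 := hint 1 1
  have hi12 := hint 1 2
  rw [integral_add ((continuousOn_partialD (hf 0) 0).integrableOn_compact
      isCompact_refTriangle) ((continuousOn_partialD (hf 1) 1).integrableOn_compact
      isCompact_refTriangle), integral_partialD_zero (hf 0), integral_partialD_one (hf 1)]
  -- Slicing traverses the hypotenuse by its first coordinate and the vertical side upwards, both
  -- against the counterclockwise orientation; s ↦ 1 - s reverses them.
  have e1 : ∀ g : Coord → ℝ, ∫ s in (0 : ℝ)..1, g ![s, 1 - s]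
      = ∫ s in (0 : ℝ)..1, g (sidePt 1 s) := by
    intro g
    have := intervalIntegral.integral_comp_sub_left (a := 0) (b := 1)
      (fun s => g (sidePt 1 s)) 1
    simpa [sidePt_one_eq] using this
  have e2 : ∀ g : Coord → ℝ, ∫ s in (0 : ℝ)..1, g ![0, s]
      = ∫ s in (0 : ℝ)..1, g (sidePt 2 s) := by
    intro g
    have := intervalIntegral.integral_comp_sub_left (a := 0) (b := 1)
      (fun s => g (sidePt 2 s)) 1
    simpa [sidePt_two_eq] using this
  have i2 : IntervalIntegrable (fun s => f 0 ![0, s]) volume 0 1 := by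
    have := hi02.comp_sub_left 1
    simpa [sidePt_two_eq] using this.symm
  have i1 : IntervalIntegrable (fun s => f 1 ![s, 1 - s]) volume 0 1 := by
    have := hi11.comp_sub_left 1
    simpa [sidePt_one_eq] using this.symm
  have i0 : IntervalIntegrable (fun s => f 1 ![s, 0]) volume 0 1 := by
    simpa [sidePt_zero_eq] using hi10
  have i3 : IntervalIntegrable (fun s => f 0 ![1 - s, s]) volume 0 1 := by
    simpa [sidePt_one_eq] using hi01
  rw [intervalIntegral.integral_sub i3 i2, intervalIntegral.integral_sub i1 i0, e1, e2]
  simp only [Fin.sum_univ_three, sideConormal_eq]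
  simp only [Matrix.cons_val_zero, Matrix.cons_val_one, Matrix.cons_val, mul_one, mul_zero,
    zero_add, add_zero, mul_neg, intervalIntegral.integral_neg]
  rw [intervalIntegral.integral_add hi01 hi11]
  simp only [sidePt_zero_eq, sidePt_one_eq, sidePt_two_eq]
  ring

/-- Differentiation under the integral sign over a compact set, with one-sided derivatives at the
ends of the parameter interval. -/
theorem hasDerivWithinAt_setIntegral {X : Type*} [TopologicalSpace X] [T2Space X]
    [MeasurableSpace X] [BorelSpace X]
    {ν : Measure X} [IsFiniteMeasureOnCompacts ν] {K : Set X} (hK : IsCompact K)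
    {f f' : ℝ → X → ℝ} (hf : ∀ s ∈ Icc (0 : ℝ) 1, ContinuousOn (f s) K)
    (hf' : ContinuousOn (fun q : ℝ × X => f' q.1 q.2) (Icc 0 1 ×ˢ K))
    (hd : ∀ s ∈ Icc (0 : ℝ) 1, ∀ x ∈ K,
      HasDerivWithinAt (fun s => f s x) (f' s x) (Icc 0 1) s)
    {t : ℝ} (ht : t ∈ Icc (0 : ℝ) 1) :
    HasDerivWithinAt (fun s => ∫ x in K, f s x ∂ν) (∫ x in K, f' t x ∂ν) (Icc 0 1) t := by
  obtain ⟨C, hC⟩ := (isCompact_Icc.prod hK).exists_bound_of_continuousOn hf'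
  have hint : ∀ s ∈ Icc (0 : ℝ) 1, IntegrableOn (f s) K ν := fun s hs =>
    (hf s hs).integrableOn_compact hK
  rw [hasDerivWithinAt_iff_tendsto_slope]
  have hev : ∀ᶠ s in nhdsWithin t (Icc 0 1 \ {t}), s ∈ Icc (0 : ℝ) 1 \ {t} :=
    self_mem_nhdsWithin
  -- Dominated convergence for the difference quotients: by the mean value inequality they are
  -- bounded by the maximum C of |f'| on the compact product.
  have key : Filter.Tendsto (fun s => ∫ x in K, slope (fun s => f s x) t s ∂ν)
      (nhdsWithin t (Icc 0 1 \ {t})) (nhds (∫ x in K, f' t x ∂ν)) := by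
    refine tendsto_integral_filter_of_dominated_convergence (fun _ => C) ?_ ?_ ?_ ?_
    · filter_upwards [hev] with s hs
      simp only [slope_def_field]
      exact (((hint s hs.1).sub (hint t ht)).div_const _).aestronglyMeasurable
    · filter_upwards [hev] with s hs
      filter_upwards [ae_restrict_mem hK.measurableSet] with x hx
      have hb := (convex_Icc (0 : ℝ) 1).norm_image_sub_le_of_norm_hasDerivWithin_le
        (fun r hr => hd r hr x hx) (fun r hr => hC (r, x) ⟨hr, hx⟩) ht hs.1
      have hne : 0 < ‖s - t‖ := norm_pos_iff.2 (sub_ne_zero.2 hs.2)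
      rw [slope_def_field, norm_div, div_le_iff₀ hne]
      exact hb
    · exact integrableOn_const hK.measure_lt_top.ne
    · filter_upwards [ae_restrict_mem hK.measurableSet] with x hx
      exact hasDerivWithinAt_iff_tendsto_slope.1 (hd t ht x hx)
  refine key.congr' ?_
  filter_upwards [hev] with s hs
  simp only [slope_def_field]
  rw [integral_div, integral_sub (hint s hs.1) (hint t ht)]

/-! ### Calculus on the product of the time interval and the reference triangle -/

/-- The product of the time interval and the reference triangle. -/
def prism : Set (ℝ × Coord) := Icc (0 : ℝ) 1 ×ˢ refTriangle

/-- Smoothness up to the boundary of the prism. -/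
def SmoothOnPrism (f : ℝ × Coord → ℝ) : Prop := ContDiffOn ℝ ∞ f prism

/-- The derivative within the prism in a constant direction. -/
def dirD (X : ℝ × Coord) (f : ℝ × Coord → ℝ) (q : ℝ × Coord) : ℝ :=
  fderivWithin ℝ f prism q X

/-- The direction of time. -/
def eTime : ℝ × Coord := (1, 0)

/-- The coordinate directions in space. -/
def eSpace (a : Fin 2) : ℝ × Coord := (0, Pi.single a 1)

theorem convex_prism : Convex ℝ prism := (convex_Icc 0 1).prod convex_refTriangle

theorem interior_prism_nonempty : (interior prism).Nonempty := by
  rw [prism, interior_prod_eq, interior_Icc]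
  exact ⟨(1 / 2, interior_refTriangle_nonempty.some), by norm_num,
    interior_refTriangle_nonempty.some_mem⟩

theorem uniqueDiffOn_prism : UniqueDiffOn ℝ prism :=
  uniqueDiffOn_convex convex_prism interior_prism_nonempty

/-- Symmetry of second derivatives within a set is inherited at boundary points that are limits of
interior points. -/
theorem prism_subset_closure_interior : prism ⊆ closure (interior prism) := by
  rw [convex_prism.closure_interior_eq_closure_of_nonempty_interior interior_prism_nonempty]
  exact subset_closure

namespace SmoothOnPrism

variable {f g : ℝ × Coord → ℝ} {q : ℝ × Coord}

theorem differentiableWithinAt (hf : SmoothOnPrism f) (hq : q ∈ prism) :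
    DifferentiableWithinAt ℝ f prism q :=
  (ContDiffOn.differentiableOn hf (by simp)) q hq

theorem hasFDerivWithinAt (hf : SmoothOnPrism f) (hq : q ∈ prism) :
    HasFDerivWithinAt f (fderivWithin ℝ f prism q) prism q :=
  (hf.differentiableWithinAt hq).hasFDerivWithinAt

theorem add (hf : SmoothOnPrism f) (hg : SmoothOnPrism g) : SmoothOnPrism (f + g) :=
  ContDiffOn.add hf hg

theorem sub (hf : SmoothOnPrism f) (hg : SmoothOnPrism g) : SmoothOnPrism (f - g) :=
  ContDiffOn.sub hf hg

theorem mul (hf : SmoothOnPrism f) (hg : SmoothOnPrism g) : SmoothOnPrism (f * g) :=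
  ContDiffOn.mul hf hg

theorem smul (c : ℝ) (hf : SmoothOnPrism f) : SmoothOnPrism (c • f) :=
  ContDiffOn.const_smul c hf

theorem neg (hf : SmoothOnPrism f) : SmoothOnPrism (-f) := ContDiffOn.neg hf

theorem div (hf : SmoothOnPrism f) (hg : SmoothOnPrism g) (h0 : ∀ q ∈ prism, g q ≠ 0) :
    SmoothOnPrism (f / g) :=
  ContDiffOn.div hf hg h0

theorem sqrt (hf : SmoothOnPrism f) (h0 : ∀ q ∈ prism, 0 < f q) :
    SmoothOnPrism (fun q => √(f q)) :=
  ContDiffOn.sqrt hf fun q hq => (h0 q hq).ne'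

theorem congr (hf : SmoothOnPrism f) (h : EqOn g f prism) : SmoothOnPrism g :=
  ContDiffOn.congr hf h

theorem deriv (X : ℝ × Coord) (hf : SmoothOnPrism f) : SmoothOnPrism (dirD X f) :=
  ContDiffOn.clm_apply (ContDiffOn.fderivWithin hf uniqueDiffOn_prism (by simp)) contDiffOn_const

theorem continuousOn (hf : SmoothOnPrism f) : ContinuousOn f prism := ContDiffOn.continuousOn hf

/-- The restriction to a time slice. -/
theorem slice (hf : SmoothOnPrism f) {t : ℝ} (ht : t ∈ Icc (0 : ℝ) 1) {n : ℕ∞} :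
    ContDiffOn ℝ n (fun x => f (t, x)) refTriangle := by
  have h : ContDiffOn ℝ n f prism := ContDiffOn.of_le hf (by exact_mod_cast le_top)
  exact h.comp (contDiff_prodMk_right t).contDiffOn fun x hx => ⟨ht, hx⟩

theorem hasFDerivWithinAt_slice (hf : SmoothOnPrism f) (hq : q ∈ prism) :
    HasFDerivWithinAt (fun x => f (q.1, x))
      ((fderivWithin ℝ f prism q).comp (ContinuousLinearMap.inr ℝ ℝ Coord)) refTriangle q.2 :=
  (hf.hasFDerivWithinAt hq).comp q.2 (hasFDerivAt_prodMk_right q.1 q.2).hasFDerivWithinAt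
    (show MapsTo (fun x => (q.1, x)) refTriangle prism from fun _ hx => ⟨hq.1, hx⟩)

/-- The bridge from the spatial derivatives used in the definitions of the geometry to the calculus
on the prism, where time and space are treated alike. -/
theorem partialD_slice (hf : SmoothOnPrism f) (a : Fin 2) (hq : q ∈ prism) :
    partialD a (fun x => f (q.1, x)) q.2 = dirD (eSpace a) f q := by
  rw [partialD, (hf.hasFDerivWithinAt_slice hq).fderivWithin (uniqueDiffOn_refTriangle _ hq.2)]
  rfl

theorem hasDerivWithinAt_time (hf : SmoothOnPrism f) (hq : q ∈ prism) :
    HasDerivWithinAt (fun s => f (s, q.2)) (dirD eTime f q) (Icc 0 1) q.1 :=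
  (hf.hasFDerivWithinAt hq).comp_hasDerivWithinAt q.1
    ((hasDerivAt_id' q.1).prodMk (hasDerivAt_const q.1 q.2)).hasDerivWithinAt
    (show MapsTo (fun s => (s, q.2)) (Icc 0 1) prism from fun _ hs => ⟨hs, hq.2⟩)

theorem hasDerivWithinAt_side (hf : SmoothOnPrism f) (k : Fin 3) {t s : ℝ}
    (ht : t ∈ Icc (0 : ℝ) 1) (hs : s ∈ Icc (0 : ℝ) 1) :
    HasDerivWithinAt (fun s => f (t, sidePt k s))
      (sideDir k 0 * dirD (eSpace 0) f (t, sidePt k s) + sideDir k 1 * dirD (eSpace 1) f (t, sidePt k s))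
      (Icc 0 1) s := by
  have h := (hf.hasFDerivWithinAt (q := (t, sidePt k s))
    ⟨ht, sidePt_mem k hs⟩).comp_hasDerivWithinAt s
    ((hasDerivAt_const s t).prodMk (hasDerivAt_sidePt k s)).hasDerivWithinAt
    (show MapsTo (fun r => (t, sidePt k r)) (Icc 0 1) prism from
      fun _ hr => ⟨ht, sidePt_mem k hr⟩)
  refine h.congr_deriv ?_
  have : ((0, sideDir k) : ℝ × Coord)
      = sideDir k 0 • (0, Pi.single 0 1) + sideDir k 1 • (0, Pi.single 1 1) := by
    ext i
    · simp
    · fin_cases i <;> simp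
  rw [this, map_add, map_smul, map_smul]
  rfl

end SmoothOnPrism

/-! ### Differentiation rules on the prism. -/

section rules

variable {f g : ℝ × Coord → ℝ} {q : ℝ × Coord} (X Y : ℝ × Coord)

theorem dirD_congr (h : EqOn f g prism) (hq : q ∈ prism) : dirD X f q = dirD X g q := by
  rw [dirD, dirD, fderivWithin_congr h (h hq)]

theorem dirD_add (hf : SmoothOnPrism f) (hg : SmoothOnPrism g) (hq : q ∈ prism) :
    dirD X (f + g) q = dirD X f q + dirD X g q := by
  rw [dirD, fderivWithin_add (uniqueDiffOn_prism q hq) (hf.differentiableWithinAt hq)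
    (hg.differentiableWithinAt hq)]
  rfl

theorem dirD_sub (hf : SmoothOnPrism f) (hg : SmoothOnPrism g) (hq : q ∈ prism) :
    dirD X (f - g) q = dirD X f q - dirD X g q := by
  rw [dirD, fderivWithin_sub (uniqueDiffOn_prism q hq) (hf.differentiableWithinAt hq)
    (hg.differentiableWithinAt hq)]
  rfl

theorem dirD_neg (hq : q ∈ prism) : dirD X (-f) q = -dirD X f q := by
  rw [dirD, fderivWithin_neg (uniqueDiffOn_prism q hq)]
  rfl

theorem dirD_mul (hf : SmoothOnPrism f) (hg : SmoothOnPrism g) (hq : q ∈ prism) :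
    dirD X (f * g) q = f q * dirD X g q + g q * dirD X f q := by
  rw [dirD, fderivWithin_mul (uniqueDiffOn_prism q hq) (hf.differentiableWithinAt hq)
    (hg.differentiableWithinAt hq)]
  rfl

theorem dirD_smul (c : ℝ) (hf : SmoothOnPrism f) (hq : q ∈ prism) :
    dirD X (c • f) q = c * dirD X f q := by
  rw [dirD, fderivWithin_const_smul (uniqueDiffOn_prism q hq) (hf.differentiableWithinAt hq)]
  rfl

/-- The product rule for (f / g) * g, which equals f on the prism. -/
theorem dirD_div (hf : SmoothOnPrism f) (hg : SmoothOnPrism g) (h0 : ∀ q ∈ prism, g q ≠ 0)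
    (hq : q ∈ prism) :
    dirD X (f / g) q = (g q * dirD X f q - f q * dirD X g q) / g q ^ 2 := by
  have h := dirD_mul X (hf.div hg h0) hg hq
  rw [dirD_congr X (g := f) (fun p hp => by simp [h0 p hp]) hq] at h
  have := h0 q hq
  rw [h, Pi.div_apply]
  field_simp
  ring

/-- The product rule for √f * √f. In this logarithmic form the root stays a factor, so that in later
identities √det g can be cancelled and only rational expressions remain. -/
theorem dirD_sqrt (hf : SmoothOnPrism f) (h0 : ∀ q ∈ prism, 0 < f q) (hq : q ∈ prism) :
    dirD X (fun q => √(f q)) q = √(f q) * (dirD X f q / (2 * f q)) := by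
  have hs := hf.sqrt h0
  have h := dirD_mul X hs hs hq
  rw [dirD_congr X (g := f) (fun p hp => by simp [Real.mul_self_sqrt (h0 p hp).le]) hq] at h
  have h1 := Real.sqrt_pos.2 (h0 q hq)
  have h2 := Real.mul_self_sqrt (h0 q hq).le
  have h3 := h0 q hq
  rw [h]
  field_simp
  rw [Real.sq_sqrt h3.le]
  ring

theorem dirD_comm (hf : SmoothOnPrism f) (hq : q ∈ prism) :
    dirD X (dirD Y f) q = dirD Y (dirD X f) q := by
  have hd : DifferentiableWithinAt ℝ (fderivWithin ℝ f prism) prism q :=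
    (ContDiffOn.fderivWithin (m := 1) hf uniqueDiffOn_prism
      (by rw [one_add_one_eq_two]; exact ENat.LEInfty.out)).differentiableOn one_ne_zero q hq
  have key : ∀ X Y, dirD X (dirD Y f) q = fderivWithin ℝ (fderivWithin ℝ f prism) prism q X Y := by
    intro X Y
    have h : HasFDerivWithinAt (dirD Y f) _ prism q :=
      hd.hasFDerivWithinAt.clm_apply (hasFDerivWithinAt_const Y q prism)
    rw [dirD, h.fderivWithin (uniqueDiffOn_prism q hq)]
    simp
  have hsymm : IsSymmSndFDerivWithinAt ℝ f prism q :=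
    ContDiffWithinAt.isSymmSndFDerivWithinAt (hf q hq)
      (by rw [minSmoothness_of_isRCLikeNormedField]; exact ENat.LEInfty.out) uniqueDiffOn_prism
      (prism_subset_closure_interior hq) hq
  rw [key, key, hsymm.eq]

end rules

/-- Differentiation under the integral over the triangle. -/
theorem hasDerivWithinAt_integral_refTriangle {w : Coord → ℝ} (hw : ContinuousOn w refTriangle)
    {f : ℝ × Coord → ℝ} (hf : SmoothOnPrism f) {t : ℝ} (ht : t ∈ Icc (0 : ℝ) 1) :
    HasDerivWithinAt (fun s => ∫ x in refTriangle, w x * f (s, x))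
      (∫ x in refTriangle, w x * dirD eTime f (t, x)) (Icc 0 1) t := by
  refine hasDerivWithinAt_setIntegral (f := fun s x => w x * f (s, x))
    (f' := fun s x => w x * dirD eTime f (s, x)) isCompact_refTriangle (fun s hs => ?_) ?_
    (fun s hs x hx => ?_) ht
  · exact hw.mul (hf.slice (n := 0) hs).continuousOn
  · exact (hw.comp continuousOn_snd fun q hq => hq.2).mul (hf.deriv _).continuousOn
  · exact (hf.hasDerivWithinAt_time (q := (s, x)) ⟨hs, hx⟩).const_mul (w x)

/-- Differentiation under the integral over a side. -/
theorem hasDerivWithinAt_integral_side {w : Coord → ℝ} (hw : ContinuousOn w refTriangle)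
    {f : ℝ × Coord → ℝ} (hf : SmoothOnPrism f) (k : Fin 3) {t : ℝ} (ht : t ∈ Icc (0 : ℝ) 1) :
    HasDerivWithinAt (fun r => ∫ s in (0 : ℝ)..1, w (sidePt k s) * f (r, sidePt k s))
      (∫ s in (0 : ℝ)..1, w (sidePt k s) * dirD eTime f (t, sidePt k s)) (Icc 0 1) t := by
  simp only [intervalIntegral.integral_of_le zero_le_one, ← integral_Icc_eq_integral_Ioc]
  have hmaps : MapsTo (sidePt k) (Icc 0 1) refTriangle := fun s hs => sidePt_mem k hs
  have hwk : ContinuousOn (fun s => w (sidePt k s)) (Icc 0 1) :=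
    hw.comp (continuous_sidePt k).continuousOn hmaps
  refine hasDerivWithinAt_setIntegral (f := fun r s => w (sidePt k s) * f (r, sidePt k s))
    (f' := fun r s => w (sidePt k s) * dirD eTime f (r, sidePt k s)) isCompact_Icc (fun r hr => ?_) ?_
    (fun r hr s hs => ?_) ht
  · exact hwk.mul ((hf.slice (n := 0) hr).continuousOn.comp (continuous_sidePt k).continuousOn
      hmaps)
  · refine (hwk.comp continuousOn_snd fun q hq => hq.2).mul ?_
    exact (hf.deriv _).continuousOn.comp (f := fun q : ℝ × ℝ => (q.1, sidePt k q.2))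
      (continuous_fst.prodMk ((continuous_sidePt k).comp continuous_snd)).continuousOn
      fun q hq => ⟨hq.1, hmaps hq.2⟩
  · exact (hf.hasDerivWithinAt_time (q := (r, sidePt k s)) ⟨hr, hmaps hs⟩).const_mul _

/-! ### Families of metrics on the reference triangle -/

/-- A family of Riemannian metrics on the reference triangle, smooth in time and space. -/
structure MetricFamily (G : ℝ → MatField) : Prop where
  smooth : ∀ a b, SmoothOnPrism fun q => G q.1 q.2 a b
  symm : ∀ q ∈ prism, G q.1 q.2 1 0 = G q.1 q.2 0 1
  pos : ∀ q ∈ prism, 0 < G q.1 q.2 0 0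
  det_pos : ∀ q ∈ prism, 0 < G q.1 q.2 0 0 * G q.1 q.2 1 1 - G q.1 q.2 0 1 * G q.1 q.2 0 1

section defs

variable (G : ℝ → MatField)

/-- The coefficient `g₀₀`. -/
def metE : ℝ × Coord → ℝ := fun q => G q.1 q.2 0 0

/-- The coefficient `g₀₁`. -/
def metF : ℝ × Coord → ℝ := fun q => G q.1 q.2 0 1

/-- The coefficient `g₁₁`. -/
def metH : ℝ × Coord → ℝ := fun q => G q.1 q.2 1 1

/-- The matrix of coefficient functions, symmetric by definition. -/
def metCoef : Fin 2 → Fin 2 → ℝ × Coord → ℝ := ![![metE G, metF G], ![metF G, metH G]]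

/-- The determinant of the metric. -/
def metDet : ℝ × Coord → ℝ := metE G * metH G - metF G * metF G

/-- The area density. -/
def metRoot : ℝ × Coord → ℝ := fun q => √(metDet G q)

/-- Twice the Christoffel symbols of the first kind. -/
def lowGam (d a b : Fin 2) : ℝ × Coord → ℝ :=
  dirD (eSpace a) (metCoef G b d) + dirD (eSpace b) (metCoef G a d) - dirD (eSpace d) (metCoef G a b)

/-- The Christoffel symbols as functions of time and space. -/
def gam (c a b : Fin 2) : ℝ × Coord → ℝ := fun q => christoffel (G q.1) c a b q.2

/-- The squared length of a constant vector. -/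
def lenSq (d : Coord) : ℝ × Coord → ℝ :=
  (d 0 ^ 2) • metE G + (2 * (d 0 * d 1)) • metF G + (d 1 ^ 2) • metH G

/-- The contraction of the Christoffel symbols with a constant vector `d` and its conormal. -/
def connNum (d : Coord) (a : Fin 2) : ℝ × Coord → ℝ :=
  (d 0 * d 1) • gam G 0 a 0 + (d 1 ^ 2) • gam G 0 a 1 - (d 0 ^ 2) • gam G 1 a 0
    - (d 0 * d 1) • gam G 1 a 1

/-- The connection form of the orthonormal frame that starts with the constant direction `d`. -/
def conn (d : Coord) (a : Fin 2) : ℝ × Coord → ℝ := -(metRoot G * connNum G d a / lenSq G d)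

/-- The density `½ (𝕊σ)^{ab} √det g` for `σ = ∂_t g`. -/
def stress : Fin 2 → Fin 2 → ℝ × Coord → ℝ :=
  ![![(-1 / 2 : ℝ) • (metRoot G * dirD eTime (metH G) / metDet G),
      (1 / 2 : ℝ) • (metRoot G * dirD eTime (metF G) / metDet G)],
    ![(1 / 2 : ℝ) • (metRoot G * dirD eTime (metF G) / metDet G),
      (-1 / 2 : ℝ) • (metRoot G * dirD eTime (metE G) / metDet G)]]

/-- The covariant divergence of `stress`. -/
def flux (a : Fin 2) : ℝ × Coord → ℝ :=
  dirD (eSpace 0) (stress G a 0) + dirD (eSpace 1) (stress G a 1)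
    + (gam G a 0 0 * stress G 0 0 + gam G a 0 1 * stress G 0 1
      + gam G a 1 0 * stress G 1 0 + gam G a 1 1 * stress G 1 1)

/-- The numerator of `rotRate`. -/
def rotNum (d : Coord) : ℝ × Coord → ℝ :=
  (d 0 * d 1) • (dirD eTime (metE G) * metH G - dirD eTime (metH G) * metE G)
    + (d 0 ^ 2) • (dirD eTime (metE G) * metF G - dirD eTime (metF G) * metE G)
    + (d 1 ^ 2) • (dirD eTime (metF G) * metH G - dirD eTime (metH G) * metF G)

/-- `-½ σ(n, τ)` for `σ = ∂_t g`, with `τ` the unit vector in the direction `d` and `n` its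
rotation by a right angle. -/
def rotRate (d : Coord) : ℝ × Coord → ℝ :=
  (-1 / 2 : ℝ) • (metRoot G * rotNum G d / (metDet G * lenSq G d))

end defs

namespace MetricFamily

variable {G : ℝ → MatField} (hG : MetricFamily G)
include hG

theorem smooth_metE : SmoothOnPrism (metE G) := hG.smooth 0 0

theorem smooth_metF : SmoothOnPrism (metF G) := hG.smooth 0 1

theorem smooth_metH : SmoothOnPrism (metH G) := hG.smooth 1 1

theorem smooth_metCoef (a b : Fin 2) : SmoothOnPrism (metCoef G a b) := by
  fin_cases a <;> fin_cases b
  exacts [hG.smooth_metE, hG.smooth_metF, hG.smooth_metF, hG.smooth_metH]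

/-- Symmetry of the metric is known on the prism only. This suffices, since derivatives within the
prism at its points depend on the values there alone. -/
theorem coef_eqOn (a b : Fin 2) : EqOn (fun q => G q.1 q.2 a b) (metCoef G a b) prism := by
  intro q hq
  fin_cases a <;> fin_cases b
  exacts [rfl, rfl, hG.symm q hq, rfl]

theorem metE_pos : ∀ q ∈ prism, 0 < metE G q := hG.pos

theorem metDet_pos : ∀ q ∈ prism, 0 < metDet G q := hG.det_pos

theorem metDet_ne : ∀ q ∈ prism, metDet G q ≠ 0 := fun q hq => (hG.metDet_pos q hq).ne'

theorem smooth_metDet : SmoothOnPrism (metDet G) :=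
  (hG.smooth_metE.mul hG.smooth_metH).sub (hG.smooth_metF.mul hG.smooth_metF)

theorem smooth_metRoot : SmoothOnPrism (metRoot G) := hG.smooth_metDet.sqrt hG.metDet_pos

theorem matrix_eq {q : ℝ × Coord} (hq : q ∈ prism) :
    G q.1 q.2 = !![metE G q, metF G q; metF G q, metH G q] := by
  ext a b
  rw [show G q.1 q.2 a b = metCoef G a b q from hG.coef_eqOn a b hq]
  fin_cases a <;> fin_cases b <;> rfl

theorem matrix_det {q : ℝ × Coord} (hq : q ∈ prism) : (G q.1 q.2).det = metDet G q := by
  rw [hG.matrix_eq hq, Matrix.det_fin_two_of]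
  rfl

theorem matrix_inv {q : ℝ × Coord} (hq : q ∈ prism) :
    (G q.1 q.2)⁻¹ = !![metH G q / metDet G q, -metF G q / metDet G q;
      -metF G q / metDet G q, metE G q / metDet G q] := by
  rw [Matrix.inv_def, hG.matrix_det hq, hG.matrix_eq hq, Matrix.adjugate_fin_two_of,
    Ring.inverse_eq_inv']
  ext a b
  fin_cases a <;> fin_cases b <;> simp <;> ring

/-! ### The Levi-Civita connection in coordinates. -/

theorem smooth_lowGam (d a b : Fin 2) : SmoothOnPrism (lowGam G d a b) :=
  (((hG.smooth_metCoef b d).deriv _).add ((hG.smooth_metCoef a d).deriv _)).sub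
    ((hG.smooth_metCoef a b).deriv _)

theorem partialD_coef (a b c : Fin 2) {q : ℝ × Coord} (hq : q ∈ prism) :
    partialD c (fun y => G q.1 y a b) q.2 = dirD (eSpace c) (metCoef G a b) q := by
  rw [← dirD_congr _ (hG.coef_eqOn a b) hq]
  exact (hG.smooth a b).partialD_slice c hq

theorem gam_eq (c a b : Fin 2) {q : ℝ × Coord} (hq : q ∈ prism) :
    gam G c a b q = (1 / 2) * ((G q.1 q.2)⁻¹ c 0 * lowGam G 0 a b q
      + (G q.1 q.2)⁻¹ c 1 * lowGam G 1 a b q) := by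
  simp only [gam, christoffel, Fin.sum_univ_two, hG.partialD_coef _ _ _ hq]
  rfl

theorem gam_zero (a b : Fin 2) : EqOn (gam G 0 a b)
    ((1 / 2 : ℝ) • ((metH G * lowGam G 0 a b - metF G * lowGam G 1 a b) / metDet G)) prism := by
  intro q hq
  rw [hG.gam_eq 0 a b hq, hG.matrix_inv hq]
  simp
  ring

theorem gam_one (a b : Fin 2) : EqOn (gam G 1 a b)
    ((1 / 2 : ℝ) • ((metE G * lowGam G 1 a b - metF G * lowGam G 0 a b) / metDet G)) prism := by
  intro q hq
  rw [hG.gam_eq 1 a b hq, hG.matrix_inv hq]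
  simp
  ring

theorem smooth_gam (c a b : Fin 2) : SmoothOnPrism (gam G c a b) := by
  have hE := hG.smooth_metE
  have hF := hG.smooth_metF
  have hH := hG.smooth_metH
  have h0 := hG.smooth_lowGam 0 a b
  have h1 := hG.smooth_lowGam 1 a b
  fin_cases c
  · exact ((((hH.mul h0).sub (hF.mul h1)).div hG.smooth_metDet hG.metDet_ne).smul _).congr
      (hG.gam_zero a b)
  · exact ((((hE.mul h1).sub (hF.mul h0)).div hG.smooth_metDet hG.metDet_ne).smul _).congr
      (hG.gam_one a b)

/-- Lowering the index of the Christoffel symbols. -/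
theorem lower_zero (a b : Fin 2) : EqOn (lowGam G 0 a b)
    ((2 : ℝ) • (metE G * gam G 0 a b + metF G * gam G 1 a b)) prism := by
  intro q hq
  have h := hG.metDet_ne q hq
  simp only [Pi.smul_apply, Pi.add_apply, Pi.mul_apply, hG.gam_zero a b hq, hG.gam_one a b hq,
    Pi.sub_apply, Pi.div_apply, smul_eq_mul]
  field_simp
  simp only [metDet, Pi.sub_apply, Pi.mul_apply]
  ring

theorem lower_one (a b : Fin 2) : EqOn (lowGam G 1 a b)
    ((2 : ℝ) • (metF G * gam G 0 a b + metH G * gam G 1 a b)) prism := by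
  intro q hq
  have h := hG.metDet_ne q hq
  simp only [Pi.smul_apply, Pi.add_apply, Pi.mul_apply, hG.gam_zero a b hq, hG.gam_one a b hq,
    Pi.sub_apply, Pi.div_apply, smul_eq_mul]
  field_simp
  simp only [metDet, Pi.sub_apply, Pi.mul_apply]
  ring

theorem gam_comm (c a b : Fin 2) {q : ℝ × Coord} (hq : q ∈ prism) :
    gam G c a b q = gam G c b a q := by
  rw [hG.gam_eq c a b hq, hG.gam_eq c b a hq]
  have : ∀ d, lowGam G d a b q = lowGam G d b a q := by
    intro d
    have : metCoef G a b = metCoef G b a := by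
      fin_cases a <;> fin_cases b <;> rfl
    simp only [lowGam, Pi.add_apply, Pi.sub_apply, this]
    ring
  rw [this, this]

/-- Compatibility of the connection with the metric. -/
theorem dSpace_metE (a : Fin 2) : EqOn (dirD (eSpace a) (metE G))
    ((2 : ℝ) • (metE G * gam G 0 a 0 + metF G * gam G 1 a 0)) prism := by
  intro q hq
  rw [← hG.lower_zero a 0 hq]
  simp only [lowGam, Pi.add_apply, Pi.sub_apply]
  simp [metCoef]

theorem dSpace_metH (a : Fin 2) : EqOn (dirD (eSpace a) (metH G))
    ((2 : ℝ) • (metF G * gam G 0 a 1 + metH G * gam G 1 a 1)) prism := by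
  intro q hq
  rw [← hG.lower_one a 1 hq]
  simp only [lowGam, Pi.add_apply, Pi.sub_apply]
  simp [metCoef]

theorem dSpace_metF (a : Fin 2) : EqOn (dirD (eSpace a) (metF G))
    (metF G * gam G 0 a 0 + metH G * gam G 1 a 0 + metE G * gam G 0 a 1 + metF G * gam G 1 a 1)
    prism := by
  intro q hq
  have h1 := hG.lower_one a 0 hq
  have h2 := hG.lower_zero a 1 hq
  simp only [lowGam, Pi.add_apply, Pi.sub_apply, Pi.smul_apply, Pi.mul_apply, smul_eq_mul] at h1 h2 ⊢
  have e1 : metCoef G 0 1 = metF G := rfl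
  have e2 : metCoef G 1 0 = metF G := rfl
  rw [e1] at h1
  rw [e2] at h2
  linarith

theorem dirD_metDet (X : ℝ × Coord) {q : ℝ × Coord} (hq : q ∈ prism) :
    dirD X (metDet G) q = metE G q * dirD X (metH G) q + metH G q * dirD X (metE G) q
      - 2 * metF G q * dirD X (metF G) q := by
  have hE := hG.smooth_metE
  have hF := hG.smooth_metF
  have hH := hG.smooth_metH
  rw [metDet, dirD_sub X (hE.mul hH) (hF.mul hF) hq, dirD_mul X hE hH hq, dirD_mul X hF hF hq]
  ring

theorem dirD_metRoot (X : ℝ × Coord) {q : ℝ × Coord} (hq : q ∈ prism) :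
    dirD X (metRoot G) q = metRoot G q * (dirD X (metDet G) q / (2 * metDet G q)) :=
  dirD_sqrt X hG.smooth_metDet hG.metDet_pos hq

/-- The trace of metric compatibility. It lets every spatial derivative of the metric be eliminated
in favour of Christoffel symbols. -/
theorem dSpace_metDet (a : Fin 2) {q : ℝ × Coord} (hq : q ∈ prism) :
    dirD (eSpace a) (metDet G) q = 2 * metDet G q * (gam G 0 a 0 q + gam G 1 a 1 q) := by
  rw [hG.dirD_metDet _ hq, hG.dSpace_metE a hq, hG.dSpace_metF a hq, hG.dSpace_metH a hq]
  simp only [metDet, Pi.add_apply, Pi.sub_apply, Pi.smul_apply, Pi.mul_apply, smul_eq_mul]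
  ring

theorem dSpace_metRoot (a : Fin 2) {q : ℝ × Coord} (hq : q ∈ prism) :
    dirD (eSpace a) (metRoot G) q = metRoot G q * (gam G 0 a 0 q + gam G 1 a 1 q) := by
  have h := hG.metDet_ne q hq
  rw [hG.dirD_metRoot _ hq, hG.dSpace_metDet a hq]
  field_simp

/-- Completing the square after multiplication by g₀₀ > 0. -/
theorem lenSq_pos {d : Coord} (hd : d ≠ 0) : ∀ q ∈ prism, 0 < lenSq G d q := by
  intro q hq
  have hE := hG.metE_pos q hq
  have hD := hG.metDet_pos q hq
  have key : metE G q * lenSq G d q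
      = (d 0 * metE G q + d 1 * metF G q) ^ 2 + d 1 ^ 2 * metDet G q := by
    simp only [lenSq, metDet, Pi.add_apply, Pi.sub_apply, Pi.smul_apply, Pi.mul_apply, smul_eq_mul]
    ring
  have h : 0 < metE G q * lenSq G d q := by
    rw [key]
    by_cases h1 : d 1 = 0
    · have h0 : d 0 ≠ 0 := fun h0 => hd (by ext i; fin_cases i <;> simp [h0, h1])
      simp only [h1, zero_mul, add_zero]
      positivity
    · positivity
  exact (pos_iff_pos_of_mul_pos h).1 hE

theorem smooth_lenSq (d : Coord) : SmoothOnPrism (lenSq G d) :=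
  ((hG.smooth_metE.smul _).add (hG.smooth_metF.smul _)).add (hG.smooth_metH.smul _)

theorem dirD_lenSq (d : Coord) (X : ℝ × Coord) {q : ℝ × Coord} (hq : q ∈ prism) :
    dirD X (lenSq G d) q = d 0 ^ 2 * dirD X (metE G) q + 2 * (d 0 * d 1) * dirD X (metF G) q
      + d 1 ^ 2 * dirD X (metH G) q := by
  have hE := hG.smooth_metE
  have hF := hG.smooth_metF
  have hH := hG.smooth_metH
  rw [lenSq, dirD_add X ((hE.smul _).add (hF.smul _)) (hH.smul _) hq,
    dirD_add X (hE.smul _) (hF.smul _) hq, dirD_smul X _ hE hq, dirD_smul X _ hF hq,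
    dirD_smul X _ hH hq]

/-! ### The connection form of a frame with constant first direction. -/

theorem smooth_connNum (d : Coord) (a : Fin 2) : SmoothOnPrism (connNum G d a) :=
  ((((hG.smooth_gam 0 a 0).smul _).add ((hG.smooth_gam 0 a 1).smul _)).sub
    ((hG.smooth_gam 1 a 0).smul _)).sub ((hG.smooth_gam 1 a 1).smul _)

theorem dirD_connNum (d : Coord) (a : Fin 2) (X : ℝ × Coord) {q : ℝ × Coord} (hq : q ∈ prism) :
    dirD X (connNum G d a) q = d 0 * d 1 * dirD X (gam G 0 a 0) q
      + d 1 ^ 2 * dirD X (gam G 0 a 1) q - d 0 ^ 2 * dirD X (gam G 1 a 0) q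
      - d 0 * d 1 * dirD X (gam G 1 a 1) q := by
  have h1 := hG.smooth_gam 0 a 0
  have h2 := hG.smooth_gam 0 a 1
  have h3 := hG.smooth_gam 1 a 0
  have h4 := hG.smooth_gam 1 a 1
  rw [connNum, dirD_sub X (((h1.smul _).add (h2.smul _)).sub (h3.smul _)) (h4.smul _) hq,
    dirD_sub X ((h1.smul _).add (h2.smul _)) (h3.smul _) hq,
    dirD_add X (h1.smul _) (h2.smul _) hq, dirD_smul X _ h1 hq, dirD_smul X _ h2 hq,
    dirD_smul X _ h3 hq, dirD_smul X _ h4 hq]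

theorem smooth_conn {d : Coord} (hd : d ≠ 0) (a : Fin 2) : SmoothOnPrism (conn G d a) :=
  ((hG.smooth_metRoot.mul (hG.smooth_connNum d a)).div (hG.smooth_lenSq d)
    fun q hq => (hG.lenSq_pos hd q hq).ne').neg

theorem dirD_conn {d : Coord} (hd : d ≠ 0) (a : Fin 2) (X : ℝ × Coord) {q : ℝ × Coord}
    (hq : q ∈ prism) :
    dirD X (conn G d a) q = -metRoot G q * (dirD X (metDet G) q / (2 * metDet G q)
      * connNum G d a q / lenSq G d q + dirD X (connNum G d a) q / lenSq G d q
      - connNum G d a q * dirD X (lenSq G d) q / lenSq G d q ^ 2) := by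
  have hr := hG.smooth_metRoot
  have hN := hG.smooth_connNum d a
  have h0 := (hG.lenSq_pos hd q hq).ne'
  have hD := hG.metDet_ne q hq
  rw [conn, dirD_neg X hq, dirD_div X (hr.mul hN) (hG.smooth_lenSq d)
    (fun q hq => (hG.lenSq_pos hd q hq).ne') hq, dirD_mul X hr hN hq, hG.dirD_metRoot X hq,
    Pi.mul_apply]
  field_simp
  ring

/-! ### The curvature of the family -/

theorem riemann_eq (d c a b : Fin 2) {q : ℝ × Coord} (hq : q ∈ prism) :
    riemann (G q.1) d c a b q.2 = dirD (eSpace a) (gam G d b c) q - dirD (eSpace b) (gam G d a c) q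
      + (gam G d a 0 q * gam G 0 b c q - gam G d b 0 q * gam G 0 a c q
        + (gam G d a 1 q * gam G 1 b c q - gam G d b 1 q * gam G 1 a c q)) := by
  rw [riemann, Fin.sum_univ_two, ← (hG.smooth_gam d b c).partialD_slice a hq,
    ← (hG.smooth_gam d a c).partialD_slice b hq]
  rfl

/-- The curvature form annihilates the pair `(∂₀, ∂₀)`. -/
theorem riemann_skew_zero {q : ℝ × Coord} (hq : q ∈ prism) :
    metE G q * riemann (G q.1) 0 0 0 1 q.2 + metF G q * riemann (G q.1) 1 0 0 1 q.2 = 0 := by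
  have hE := hG.smooth_metE
  have hF := hG.smooth_metF
  have expand : ∀ a b : Fin 2, dirD (eSpace a) (dirD (eSpace b) (metE G)) q
      = 2 * (metE G q * dirD (eSpace a) (gam G 0 b 0) q + gam G 0 b 0 q * dirD (eSpace a) (metE G) q
        + (metF G q * dirD (eSpace a) (gam G 1 b 0) q + gam G 1 b 0 q * dirD (eSpace a) (metF G) q)) := by
    intro a b
    have h0 := hG.smooth_gam 0 b 0
    have h1 := hG.smooth_gam 1 b 0
    rw [dirD_congr _ (hG.dSpace_metE b) hq, dirD_smul _ _ ((hE.mul h0).add (hF.mul h1)) hq,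
      dirD_add _ (hE.mul h0) (hF.mul h1) hq, dirD_mul _ hE h0 hq, dirD_mul _ hF h1 hq]
  -- By compatibility, the commutator of the second derivatives of ⟨∂₀, ∂₀⟩ is 2⟨R(∂₀, ∂₁)∂₀, ∂₀⟩.
  have h := dirD_comm (eSpace 0) (eSpace 1) hE hq
  rw [expand 0 1, expand 1 0, hG.dSpace_metE 0 hq, hG.dSpace_metE 1 hq, hG.dSpace_metF 0 hq,
    hG.dSpace_metF 1 hq] at h
  rw [hG.riemann_eq 0 0 0 1 hq, hG.riemann_eq 1 0 0 1 hq]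
  simp only [Pi.add_apply, Pi.smul_apply, Pi.mul_apply, smul_eq_mul] at h
  linear_combination h / 2

/-- Skew symmetry of the curvature form on the pair `(∂₀, ∂₁)`. -/
theorem riemann_skew_one {q : ℝ × Coord} (hq : q ∈ prism) :
    metE G q * riemann (G q.1) 0 1 0 1 q.2 + metF G q * riemann (G q.1) 1 1 0 1 q.2
      = -(metF G q * riemann (G q.1) 0 0 0 1 q.2 + metH G q * riemann (G q.1) 1 0 0 1 q.2) := by
  have hE := hG.smooth_metE
  have hF := hG.smooth_metF
  have hH := hG.smooth_metH
  have expand : ∀ a b : Fin 2, dirD (eSpace a) (dirD (eSpace b) (metF G)) q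
      = metF G q * dirD (eSpace a) (gam G 0 b 0) q + gam G 0 b 0 q * dirD (eSpace a) (metF G) q
        + (metH G q * dirD (eSpace a) (gam G 1 b 0) q + gam G 1 b 0 q * dirD (eSpace a) (metH G) q)
        + (metE G q * dirD (eSpace a) (gam G 0 b 1) q + gam G 0 b 1 q * dirD (eSpace a) (metE G) q)
        + (metF G q * dirD (eSpace a) (gam G 1 b 1) q + gam G 1 b 1 q * dirD (eSpace a) (metF G) q) := by
    intro a b
    have h0 := hG.smooth_gam 0 b 0
    have h1 := hG.smooth_gam 1 b 0
    have h2 := hG.smooth_gam 0 b 1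
    have h3 := hG.smooth_gam 1 b 1
    rw [dirD_congr _ (hG.dSpace_metF b) hq,
      dirD_add _ (((hF.mul h0).add (hH.mul h1)).add (hE.mul h2)) (hF.mul h3) hq,
      dirD_add _ ((hF.mul h0).add (hH.mul h1)) (hE.mul h2) hq,
      dirD_add _ (hF.mul h0) (hH.mul h1) hq, dirD_mul _ hF h0 hq, dirD_mul _ hH h1 hq,
      dirD_mul _ hE h2 hq, dirD_mul _ hF h3 hq]
  -- The same commutator on ⟨∂₀, ∂₁⟩ gives ⟨R(∂₀, ∂₁)∂₀, ∂₁⟩ + ⟨R(∂₀, ∂₁)∂₁, ∂₀⟩.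
  have h := dirD_comm (eSpace 0) (eSpace 1) hF hq
  rw [expand 0 1, expand 1 0, hG.dSpace_metE 0 hq, hG.dSpace_metE 1 hq, hG.dSpace_metF 0 hq,
    hG.dSpace_metF 1 hq, hG.dSpace_metH 0 hq, hG.dSpace_metH 1 hq] at h
  rw [hG.riemann_eq 0 0 0 1 hq, hG.riemann_eq 1 0 0 1 hq, hG.riemann_eq 0 1 0 1 hq,
    hG.riemann_eq 1 1 0 1 hq]
  simp only [Pi.add_apply, Pi.smul_apply, Pi.mul_apply, smul_eq_mul] at h
  linear_combination h

theorem areaDensity_eq {q : ℝ × Coord} (hq : q ∈ prism) :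
    areaDensity (G q.1) q.2 = metRoot G q := by
  rw [areaDensity, hG.matrix_det hq, metRoot]

/-- The curvature form is the exterior derivative of the connection form. -/
theorem gaussCurv_mul_areaDensity {q : ℝ × Coord} (hq : q ∈ prism) :
    gaussCurv (G q.1) q.2 * areaDensity (G q.1) q.2
      = dirD (eSpace 1) (conn G ![1, 0] 0) q - dirD (eSpace 0) (conn G ![1, 0] 1) q := by
  have hd : (![1, 0] : Coord) ≠ 0 := fun h => by simpa using congrFun h 0
  have hE := (hG.metE_pos q hq).ne'
  have hD := hG.metDet_ne q hq
  have hk1 := hG.riemann_skew_zero hq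
  have hk2 := hG.riemann_skew_one hq
  have hlen : lenSq G ![1, 0] q = metE G q := by simp [lenSq]
  have hnum : ∀ a, connNum G ![1, 0] a q = -gam G 1 a 0 q := by intro a; simp [connNum]
  -- The skew symmetries reduce K to a single curvature coefficient. For d = ∂₀ the connection form
  -- is √det g Γ¹_{a0} / g₀₀, and the claim becomes Liouville's formula for K.
  have hcurv : gaussCurv (G q.1) q.2 = -riemann (G q.1) 1 0 0 1 q.2 / metE G q := by
    rw [gaussCurv, hG.matrix_det hq, Fin.sum_univ_two, hG.matrix_eq hq]
    simp only [Matrix.of_apply, Matrix.cons_val_zero, Matrix.cons_val_one]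
    rw [hk2]
    field_simp
    simp only [metDet, Pi.sub_apply, Pi.mul_apply]
    linear_combination (-metF G q) * hk1
  rw [hcurv, hG.areaDensity_eq hq, hG.dirD_conn hd, hG.dirD_conn hd, hG.dSpace_metDet 0 hq,
    hG.dSpace_metDet 1 hq, hG.dirD_connNum, hG.dirD_connNum, hG.dirD_lenSq, hG.dirD_lenSq,
    hG.dSpace_metE 0 hq, hG.dSpace_metE 1 hq, hlen, hnum, hnum, hG.riemann_eq 1 0 0 1 hq]
  · simp only [Matrix.cons_val_zero, Matrix.cons_val_one, Pi.add_apply, Pi.smul_apply,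
      Pi.mul_apply, smul_eq_mul]
    rw [hG.gam_comm 0 1 0 hq, hG.gam_comm 1 1 0 hq]
    field_simp
    ring
  all_goals exact hq

end MetricFamily

namespace MetricFamily

variable {G : ℝ → MatField} (hG : MetricFamily G)
include hG

/-! ### The variation of the connection form -/

theorem time_lowGam (d a b : Fin 2) {q : ℝ × Coord} (hq : q ∈ prism) :
    dirD eTime (lowGam G d a b) q = dirD (eSpace a) (dirD eTime (metCoef G b d)) q
      + dirD (eSpace b) (dirD eTime (metCoef G a d)) q
      - dirD (eSpace d) (dirD eTime (metCoef G a b)) q := by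
  have h1 := hG.smooth_metCoef b d
  have h2 := hG.smooth_metCoef a d
  have h3 := hG.smooth_metCoef a b
  rw [lowGam, dirD_sub _ ((h1.deriv _).add (h2.deriv _)) (h3.deriv _) hq,
    dirD_add _ (h1.deriv _) (h2.deriv _) hq, dirD_comm _ _ h1 hq, dirD_comm _ _ h2 hq,
    dirD_comm _ _ h3 hq]

/-- Differentiating the lowered symbols avoids differentiating the inverse metric. Together with
`time_lower_one` it is a linear system for ∂_t Γ, solved below by Cramer's rule. -/
theorem time_lower_zero (a b : Fin 2) {q : ℝ × Coord} (hq : q ∈ prism) :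
    metE G q * dirD eTime (gam G 0 a b) q + metF G q * dirD eTime (gam G 1 a b) q
      = dirD eTime (lowGam G 0 a b) q / 2 - (dirD eTime (metE G) q * gam G 0 a b q
        + dirD eTime (metF G) q * gam G 1 a b q) := by
  have hE := hG.smooth_metE
  have hF := hG.smooth_metF
  have h0 := hG.smooth_gam 0 a b
  have h1 := hG.smooth_gam 1 a b
  rw [dirD_congr _ (hG.lower_zero a b) hq, dirD_smul _ _ ((hE.mul h0).add (hF.mul h1)) hq,
    dirD_add _ (hE.mul h0) (hF.mul h1) hq, dirD_mul _ hE h0 hq, dirD_mul _ hF h1 hq]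
  ring

theorem time_lower_one (a b : Fin 2) {q : ℝ × Coord} (hq : q ∈ prism) :
    metF G q * dirD eTime (gam G 0 a b) q + metH G q * dirD eTime (gam G 1 a b) q
      = dirD eTime (lowGam G 1 a b) q / 2 - (dirD eTime (metF G) q * gam G 0 a b q
        + dirD eTime (metH G) q * gam G 1 a b q) := by
  have hH := hG.smooth_metH
  have hF := hG.smooth_metF
  have h0 := hG.smooth_gam 0 a b
  have h1 := hG.smooth_gam 1 a b
  rw [dirD_congr _ (hG.lower_one a b) hq, dirD_smul _ _ ((hF.mul h0).add (hH.mul h1)) hq,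
    dirD_add _ (hF.mul h0) (hH.mul h1) hq, dirD_mul _ hF h0 hq, dirD_mul _ hH h1 hq]
  ring

theorem time_gam_zero (a b : Fin 2) {q : ℝ × Coord} (hq : q ∈ prism) :
    dirD eTime (gam G 0 a b) q = (metH G q * (dirD eTime (lowGam G 0 a b) q / 2
        - (dirD eTime (metE G) q * gam G 0 a b q + dirD eTime (metF G) q * gam G 1 a b q))
      - metF G q * (dirD eTime (lowGam G 1 a b) q / 2
        - (dirD eTime (metF G) q * gam G 0 a b q + dirD eTime (metH G) q * gam G 1 a b q)))
      / metDet G q := by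
  rw [eq_div_iff (hG.metDet_ne q hq), ← hG.time_lower_zero a b hq, ← hG.time_lower_one a b hq]
  simp only [metDet, Pi.sub_apply, Pi.mul_apply]
  ring

theorem time_gam_one (a b : Fin 2) {q : ℝ × Coord} (hq : q ∈ prism) :
    dirD eTime (gam G 1 a b) q = (metE G q * (dirD eTime (lowGam G 1 a b) q / 2
        - (dirD eTime (metF G) q * gam G 0 a b q + dirD eTime (metH G) q * gam G 1 a b q))
      - metF G q * (dirD eTime (lowGam G 0 a b) q / 2
        - (dirD eTime (metE G) q * gam G 0 a b q + dirD eTime (metF G) q * gam G 1 a b q)))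
      / metDet G q := by
  rw [eq_div_iff (hG.metDet_ne q hq), ← hG.time_lower_zero a b hq, ← hG.time_lower_one a b hq]
  simp only [metDet, Pi.sub_apply, Pi.mul_apply]
  ring

/-! ### The divergence of the stress density, and the rotation rate. -/

theorem smooth_root_mul_div {f : ℝ × Coord → ℝ} (hf : SmoothOnPrism f) :
    SmoothOnPrism (metRoot G * f / metDet G) :=
  (hG.smooth_metRoot.mul hf).div hG.smooth_metDet hG.metDet_ne

/-- `metRoot / metDet` is (det g)^(-1/2), whose logarithmic derivative is minus the trace of the
Christoffel symbols. -/
theorem dSpace_root_mul_div {f : ℝ × Coord → ℝ} (hf : SmoothOnPrism f) (a : Fin 2)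
    {q : ℝ × Coord} (hq : q ∈ prism) :
    dirD (eSpace a) (metRoot G * f / metDet G) q = metRoot G q * (dirD (eSpace a) f q
      - f q * (gam G 0 a 0 q + gam G 1 a 1 q)) / metDet G q := by
  have hD := hG.metDet_ne q hq
  rw [dirD_div _ (hG.smooth_metRoot.mul hf) hG.smooth_metDet hG.metDet_ne hq,
    dirD_mul _ hG.smooth_metRoot hf hq, hG.dSpace_metRoot a hq, hG.dSpace_metDet a hq,
    Pi.mul_apply]
  field_simp
  ring

theorem smooth_stress (a b : Fin 2) : SmoothOnPrism (stress G a b) := by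
  fin_cases a <;> fin_cases b
  exacts [(hG.smooth_root_mul_div (hG.smooth_metH.deriv _)).smul _,
    (hG.smooth_root_mul_div (hG.smooth_metF.deriv _)).smul _,
    (hG.smooth_root_mul_div (hG.smooth_metF.deriv _)).smul _,
    (hG.smooth_root_mul_div (hG.smooth_metE.deriv _)).smul _]

theorem smooth_flux (a : Fin 2) : SmoothOnPrism (flux G a) :=
  (((hG.smooth_stress a 0).deriv _).add ((hG.smooth_stress a 1).deriv _)).add
    (((((hG.smooth_gam a 0 0).mul (hG.smooth_stress 0 0)).add
      ((hG.smooth_gam a 0 1).mul (hG.smooth_stress 0 1))).add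
      ((hG.smooth_gam a 1 0).mul (hG.smooth_stress 1 0))).add
      ((hG.smooth_gam a 1 1).mul (hG.smooth_stress 1 1)))

/-- In dimension two, 𝕊σ with raised indices is -adj(σ) / det g, so no inverse metric appears in
`stress`. As `stress` is a density of weight one, its divergence has no trace term of its own; the
traces produced by (det g)^(-1/2) partly cancel the connection terms. -/
theorem flux_zero {q : ℝ × Coord} (hq : q ∈ prism) :
    flux G 0 q = metRoot G q * ((-dirD (eSpace 0) (dirD eTime (metH G)) q
      + dirD (eSpace 1) (dirD eTime (metF G)) q + dirD eTime (metH G) q * gam G 1 0 1 q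
      + dirD eTime (metF G) q * (gam G 0 0 1 q - gam G 1 1 1 q)
      - dirD eTime (metE G) q * gam G 0 1 1 q) / (2 * metDet G q)) := by
  have hD := hG.metDet_ne q hq
  have hF := hG.smooth_metF.deriv eTime
  have hH := hG.smooth_metH.deriv eTime
  simp only [flux, stress, Matrix.cons_val_zero, Matrix.cons_val_one, Pi.add_apply, Pi.mul_apply,
    Pi.smul_apply, Pi.div_apply, smul_eq_mul]
  rw [dirD_smul _ _ (hG.smooth_root_mul_div hH) hq, dirD_smul _ _ (hG.smooth_root_mul_div hF) hq,
    hG.dSpace_root_mul_div hH 0 hq, hG.dSpace_root_mul_div hF 1 hq, hG.gam_comm 0 1 0 hq]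
  field_simp
  ring

theorem flux_one {q : ℝ × Coord} (hq : q ∈ prism) :
    flux G 1 q = metRoot G q * ((dirD (eSpace 0) (dirD eTime (metF G)) q
      - dirD (eSpace 1) (dirD eTime (metE G)) q + dirD eTime (metE G) q * gam G 0 0 1 q
      + dirD eTime (metF G) q * (gam G 1 0 1 q - gam G 0 0 0 q)
      - dirD eTime (metH G) q * gam G 1 0 0 q) / (2 * metDet G q)) := by
  have hD := hG.metDet_ne q hq
  have hF := hG.smooth_metF.deriv eTime
  have hE := hG.smooth_metE.deriv eTime
  simp only [flux, stress, Matrix.cons_val_zero, Matrix.cons_val_one, Pi.add_apply, Pi.mul_apply,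
    Pi.smul_apply, Pi.div_apply, smul_eq_mul]
  rw [dirD_smul _ _ (hG.smooth_root_mul_div hE) hq, dirD_smul _ _ (hG.smooth_root_mul_div hF) hq,
    hG.dSpace_root_mul_div hE 1 hq, hG.dSpace_root_mul_div hF 0 hq, hG.gam_comm 0 1 0 hq,
    hG.gam_comm 1 1 0 hq]
  field_simp
  ring

theorem smooth_rotNum (d : Coord) : SmoothOnPrism (rotNum G d) := by
  have hE := hG.smooth_metE
  have hF := hG.smooth_metF
  have hH := hG.smooth_metH
  have hE' := hE.deriv eTime
  have hF' := hF.deriv eTime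
  have hH' := hH.deriv eTime
  exact ((((hE'.mul hH).sub (hH'.mul hE)).smul _).add
    (((hE'.mul hF).sub (hF'.mul hE)).smul _)).add (((hF'.mul hH).sub (hH'.mul hF)).smul _)

theorem dirD_rotNum (d : Coord) (X : ℝ × Coord) {q : ℝ × Coord} (hq : q ∈ prism) :
    dirD X (rotNum G d) q = d 0 * d 1 * (dirD eTime (metE G) q * dirD X (metH G) q
        + metH G q * dirD X (dirD eTime (metE G)) q - (dirD eTime (metH G) q * dirD X (metE G) q
        + metE G q * dirD X (dirD eTime (metH G)) q))
      + d 0 ^ 2 * (dirD eTime (metE G) q * dirD X (metF G) q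
        + metF G q * dirD X (dirD eTime (metE G)) q - (dirD eTime (metF G) q * dirD X (metE G) q
        + metE G q * dirD X (dirD eTime (metF G)) q))
      + d 1 ^ 2 * (dirD eTime (metF G) q * dirD X (metH G) q
        + metH G q * dirD X (dirD eTime (metF G)) q - (dirD eTime (metH G) q * dirD X (metF G) q
        + metF G q * dirD X (dirD eTime (metH G)) q)) := by
  have hE := hG.smooth_metE
  have hF := hG.smooth_metF
  have hH := hG.smooth_metH
  have hE' := hE.deriv eTime
  have hF' := hF.deriv eTime
  have hH' := hH.deriv eTime
  have h1 := (hE'.mul hH).sub (hH'.mul hE)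
  have h2 := (hE'.mul hF).sub (hF'.mul hE)
  have h3 := (hF'.mul hH).sub (hH'.mul hF)
  rw [rotNum, dirD_add X ((h1.smul _).add (h2.smul _)) (h3.smul _) hq,
    dirD_add X (h1.smul _) (h2.smul _) hq, dirD_smul X _ h1 hq, dirD_smul X _ h2 hq,
    dirD_smul X _ h3 hq, dirD_sub X (hE'.mul hH) (hH'.mul hE) hq,
    dirD_sub X (hE'.mul hF) (hF'.mul hE) hq, dirD_sub X (hF'.mul hH) (hH'.mul hF) hq,
    dirD_mul X hE' hH hq, dirD_mul X hH' hE hq, dirD_mul X hE' hF hq, dirD_mul X hF' hE hq,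
    dirD_mul X hF' hH hq, dirD_mul X hH' hF hq]

theorem smooth_rotRate {d : Coord} (hd : d ≠ 0) : SmoothOnPrism (rotRate G d) :=
  ((hG.smooth_metRoot.mul (hG.smooth_rotNum d)).div (hG.smooth_metDet.mul (hG.smooth_lenSq d))
    fun q hq => mul_ne_zero (hG.metDet_ne q hq) (hG.lenSq_pos hd q hq).ne').smul _

theorem dSpace_rotRate {d : Coord} (hd : d ≠ 0) (a : Fin 2) {q : ℝ × Coord} (hq : q ∈ prism) :
    dirD (eSpace a) (rotRate G d) q = metRoot G q * (-1 / 2 * (dirD (eSpace a) (rotNum G d) q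
        / (metDet G q * lenSq G d q)
      - rotNum G d q * (gam G 0 a 0 q + gam G 1 a 1 q) / (metDet G q * lenSq G d q)
      - rotNum G d q * dirD (eSpace a) (lenSq G d) q / (metDet G q * lenSq G d q ^ 2))) := by
  have hL := (hG.lenSq_pos hd q hq).ne'
  have hD := hG.metDet_ne q hq
  have hne : ∀ q ∈ prism, (metDet G * lenSq G d) q ≠ 0 :=
    fun q hq => mul_ne_zero (hG.metDet_ne q hq) (hG.lenSq_pos hd q hq).ne'
  have h1 := hG.smooth_metRoot.mul (hG.smooth_rotNum d)
  have h2 := hG.smooth_metDet.mul (hG.smooth_lenSq d)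
  rw [rotRate, dirD_smul _ _ (h1.div h2 hne) hq, dirD_div _ h1 h2 hne hq,
    dirD_mul _ hG.smooth_metRoot (hG.smooth_rotNum d) hq,
    dirD_mul _ hG.smooth_metDet (hG.smooth_lenSq d) hq, hG.dSpace_metRoot a hq,
    hG.dSpace_metDet a hq, Pi.mul_apply, Pi.mul_apply]
  field_simp
  ring

/-- With `time_conn_one`, the identity ∂_t ω = *J + dρ. Another choice of d changes ω by the
differential of the angle between the two directions, so only an exact term can depend on d. The
proof is by substitution: all derivatives of the metric become Christoffel symbols, and those of σ
are matched. -/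
theorem time_conn_zero {d : Coord} (hd : d ≠ 0) {q : ℝ × Coord} (hq : q ∈ prism) :
    dirD eTime (conn G d 0) q = flux G 1 q + dirD (eSpace 0) (rotRate G d) q := by
  have hL := (hG.lenSq_pos hd q hq).ne'
  have hD := hG.metDet_ne q hq
  have hD' : metDet G q = metE G q * metH G q - metF G q * metF G q := rfl
  have hL' : lenSq G d q = d 0 ^ 2 * metE G q + 2 * (d 0 * d 1) * metF G q
    + d 1 ^ 2 * metH G q := rfl
  rw [hG.flux_one hq, hG.dSpace_rotRate hd 0 hq, hG.dirD_conn hd 0 _ hq, hG.dirD_metDet _ hq,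
    hG.dirD_lenSq _ _ hq, hG.dirD_lenSq _ _ hq, hG.dirD_connNum _ _ _ hq, hG.dirD_rotNum _ _ hq,
    hG.time_gam_zero _ _ hq, hG.time_gam_zero _ _ hq, hG.time_gam_one _ _ hq,
    hG.time_gam_one _ _ hq, hG.time_lowGam _ _ _ hq, hG.time_lowGam _ _ _ hq,
    hG.time_lowGam _ _ _ hq, hG.time_lowGam _ _ _ hq, hG.dSpace_metE 0 hq, hG.dSpace_metF 0 hq,
    hG.dSpace_metH 0 hq]
  simp only [connNum, rotNum, metCoef, Matrix.cons_val_zero, Matrix.cons_val_one, Pi.add_apply,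
    Pi.sub_apply, Pi.mul_apply, Pi.smul_apply, smul_eq_mul]
  -- Every term carries the factor √det g. Once it is cancelled the identity is rational, and
  -- polynomial after clearing denominators and inserting det g and |d|².
  rw [← mul_add, neg_mul, ← mul_neg]
  congr 1
  field_simp
  rw [hD', hL']
  ring

theorem time_conn_one {d : Coord} (hd : d ≠ 0) {q : ℝ × Coord} (hq : q ∈ prism) :
    dirD eTime (conn G d 1) q = -flux G 0 q + dirD (eSpace 1) (rotRate G d) q := by
  have hL := (hG.lenSq_pos hd q hq).ne'
  have hD := hG.metDet_ne q hq
  have hD' : metDet G q = metE G q * metH G q - metF G q * metF G q := rfl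
  have hL' : lenSq G d q = d 0 ^ 2 * metE G q + 2 * (d 0 * d 1) * metF G q
    + d 1 ^ 2 * metH G q := rfl
  rw [hG.flux_zero hq, hG.dSpace_rotRate hd 1 hq, hG.dirD_conn hd 1 _ hq, hG.dirD_metDet _ hq,
    hG.dirD_lenSq _ _ hq, hG.dirD_lenSq _ _ hq, hG.dirD_connNum _ _ _ hq, hG.dirD_rotNum _ _ hq,
    hG.time_gam_zero _ _ hq, hG.time_gam_zero _ _ hq, hG.time_gam_one _ _ hq,
    hG.time_gam_one _ _ hq, hG.time_lowGam _ _ _ hq, hG.time_lowGam _ _ _ hq,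
    hG.time_lowGam _ _ _ hq, hG.time_lowGam _ _ _ hq, hG.dSpace_metE 1 hq, hG.dSpace_metF 1 hq,
    hG.dSpace_metH 1 hq]
  simp only [connNum, rotNum, metCoef, Matrix.cons_val_zero, Matrix.cons_val_one, Pi.add_apply,
    Pi.sub_apply, Pi.mul_apply, Pi.smul_apply, smul_eq_mul]
  rw [hG.gam_comm 0 1 0 hq, hG.gam_comm 1 1 0 hq, ← mul_neg, ← mul_add, neg_mul, ← mul_neg]
  congr 1
  field_simp
  rw [hD', hL']
  ring

/-- The variation of the curvature form is the divergence of the flux. -/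
theorem time_curvature {q : ℝ × Coord} (hq : q ∈ prism) :
    dirD eTime (dirD (eSpace 1) (conn G ![1, 0] 0) - dirD (eSpace 0) (conn G ![1, 0] 1)) q
      = dirD (eSpace 0) (flux G 0) q + dirD (eSpace 1) (flux G 1) q := by
  have hd : (![1, 0] : Coord) ≠ 0 := fun h => by simpa using congrFun h 0
  have h0 := hG.smooth_conn hd 0
  have h1 := hG.smooth_conn hd 1
  have hr := hG.smooth_rotRate hd
  -- Time derivatives are moved inside, where ∂_t ω = *J + dρ applies; the two mixed derivatives of
  -- ρ then cancel.
  rw [dirD_sub _ (h0.deriv _) (h1.deriv _) hq, dirD_comm _ _ h0 hq, dirD_comm _ _ h1 hq,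
    dirD_congr (eSpace 1) (g := flux G 1 + dirD (eSpace 0) (rotRate G ![1, 0]))
      (fun p hp => hG.time_conn_zero hd hp) hq,
    dirD_congr (eSpace 0) (g := -flux G 0 + dirD (eSpace 1) (rotRate G ![1, 0]))
      (fun p hp => hG.time_conn_one hd hp) hq,
    dirD_add _ (hG.smooth_flux 1) (hr.deriv _) hq,
    dirD_add _ (hG.smooth_flux 0).neg (hr.deriv _) hq, dirD_neg _ hq,
    dirD_comm (eSpace 1) (eSpace 0) hr hq]
  ring

end MetricFamily

theorem sideDir_ne_zero (k : Fin 3) : sideDir k ≠ 0 := by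
  intro h
  have h0 := congrFun h 0
  have h1 := congrFun h 1
  fin_cases k <;> simp [sideDir_eq] at h0 h1

theorem form_eq (A : Matrix (Fin 2) (Fin 2) ℝ) (u w : Coord) :
    form A u w = u 0 * (A 0 0 * w 0 + A 0 1 * w 1) + u 1 * (A 1 0 * w 0 + A 1 1 * w 1) := by
  simp [form, dotProduct, Matrix.mulVec, Fin.sum_univ_two]

/-- The density `k ds` of the geodesic curvature of the `k`-th side, as a function on the prism. -/
def sideConn (G : ℝ → MatField) (k : Fin 3) : ℝ × Coord → ℝ :=
  sideDir k 0 • conn G (sideDir k) 0 + sideDir k 1 • conn G (sideDir k) 1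

/-- The inner product of the directions of the sides `k` and `k + 2`. -/
def cornerProd (G : ℝ → MatField) (k : Fin 3) : ℝ × Coord → ℝ :=
  (sideDir k 0 * sideDir (k + 2) 0) • metE G
    + (sideDir k 0 * sideDir (k + 2) 1 + sideDir k 1 * sideDir (k + 2) 0) • metF G
    + (sideDir k 1 * sideDir (k + 2) 1) • metH G

/-- The cosine of the angle between the `k`-th side and the reversed side `k + 2`. -/
def cornerCos (G : ℝ → MatField) (k : Fin 3) : ℝ × Coord → ℝ :=
  -(cornerProd G k / ((fun q => √(lenSq G (sideDir k) q)) *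
    fun q => √(lenSq G (sideDir (k + 2)) q)))

namespace MetricFamily

variable {G : ℝ → MatField} (hG : MetricFamily G)
include hG

/-! ### Geometry of the sides -/

theorem form_sideDir (k : Fin 3) {q : ℝ × Coord} (hq : q ∈ prism) :
    form (G q.1 q.2) (sideDir k) (sideDir k) = lenSq G (sideDir k) q := by
  rw [hG.matrix_eq hq, form_eq]
  simp [lenSq]
  ring

theorem sideSpeed_eq (k : Fin 3) {q : ℝ × Coord} (hq : q ∈ prism) :
    sideSpeed (G q.1 q.2) k = √(lenSq G (sideDir k) q) := by
  rw [sideSpeed, hG.form_sideDir k hq]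

/-- The conormal is the direction rotated by a right angle, and the inverse metric is the adjugate
over the determinant. -/
theorem norm_sideConormal (k : Fin 3) {q : ℝ × Coord} (hq : q ∈ prism) :
    √(form (G q.1 q.2)⁻¹ (sideConormal k) (sideConormal k))
      = √(lenSq G (sideDir k) q) / metRoot G q := by
  rw [metRoot, ← Real.sqrt_div (hG.lenSq_pos (sideDir_ne_zero k) q hq).le, hG.matrix_inv hq,
    form_eq]
  congr 1
  simp [lenSq, sideConormal]
  ring

theorem unitNormal_eq (k : Fin 3) {q : ℝ × Coord} (hq : q ∈ prism) :
    unitNormal (G q.1 q.2) k = (metRoot G q / (√(lenSq G (sideDir k) q) * metDet G q)) •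
      ![metH G q * sideDir k 1 + metF G q * sideDir k 0,
        -(metF G q * sideDir k 1 + metE G q * sideDir k 0)] := by
  rw [unitNormal, hG.norm_sideConormal k hq, hG.matrix_inv hq]
  ext i
  fin_cases i <;> simp [sideConormal] <;> ring

theorem smooth_sideConn (k : Fin 3) : SmoothOnPrism (sideConn G k) :=
  ((hG.smooth_conn (sideDir_ne_zero k) 0).smul _).add
    ((hG.smooth_conn (sideDir_ne_zero k) 1).smul _)

/-- The geodesic curvature of a side is the connection form of the frame adapted to it. -/
theorem geodCurv_mul_sideSpeed (k : Fin 3) {q : ℝ × Coord} (hq : q ∈ prism) :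
    geodCurv (G q.1) k q.2 * sideSpeed (G q.1 q.2) k = sideConn G k q := by
  have hL := hG.lenSq_pos (sideDir_ne_zero k) q hq
  have hD := hG.metDet_ne q hq
  have hs : √(lenSq G (sideDir k) q) ≠ 0 := (Real.sqrt_pos.2 hL).ne'
  have hs2 : √(lenSq G (sideDir k) q) ^ 2 = lenSq G (sideDir k) q := Real.sq_sqrt hL.le
  have hg : ∀ c, (∑ a, ∑ b, christoffel (G q.1) c a b q.2 * sideDir k a * sideDir k b)
      = gam G c 0 0 q * sideDir k 0 * sideDir k 0 + gam G c 0 1 q * sideDir k 0 * sideDir k 1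
        + (gam G c 1 0 q * sideDir k 1 * sideDir k 0
        + gam G c 1 1 q * sideDir k 1 * sideDir k 1) := by
    intro c
    simp only [Fin.sum_univ_two]
    rfl
  rw [geodCurv, hG.unitNormal_eq k hq, hG.sideSpeed_eq k hq, hs2, hG.matrix_eq hq, form_eq]
  simp only [hg, sideConn, conn, connNum, Pi.add_apply, Pi.smul_apply, Pi.neg_apply,
    Pi.div_apply, Pi.mul_apply, Pi.sub_apply, smul_eq_mul, Matrix.of_apply, Matrix.cons_val_zero,
    Matrix.cons_val_one]
  have hL' := hL.ne'
  field_simp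
  simp only [metDet, Pi.mul_apply, Pi.sub_apply]
  ring

/-- Since `sideConormal` is (d₁, -d₀), the first two terms are minus the flux through the side,
ready to cancel the boundary term of the divergence theorem. -/
theorem time_sideConn (k : Fin 3) {q : ℝ × Coord} (hq : q ∈ prism) :
    dirD eTime (sideConn G k) q
      = sideDir k 0 * flux G 1 q - sideDir k 1 * flux G 0 q
        + (sideDir k 0 * dirD (eSpace 0) (rotRate G (sideDir k)) q
          + sideDir k 1 * dirD (eSpace 1) (rotRate G (sideDir k)) q) := by
  have hd := sideDir_ne_zero k
  have h0 := hG.smooth_conn hd 0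
  have h1 := hG.smooth_conn hd 1
  rw [sideConn, dirD_add _ (h0.smul _) (h1.smul _) hq, dirD_smul _ _ h0 hq, dirD_smul _ _ h1 hq,
    hG.time_conn_zero hd hq, hG.time_conn_one hd hq]
  ring

/-! ### The variation of the angles -/

theorem smooth_cornerProd (k : Fin 3) : SmoothOnPrism (cornerProd G k) :=
  ((hG.smooth_metE.smul _).add (hG.smooth_metF.smul _)).add (hG.smooth_metH.smul _)

theorem smooth_cornerCos (k : Fin 3) : SmoothOnPrism (cornerCos G k) := by
  have p1 := hG.lenSq_pos (sideDir_ne_zero k)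
  have p2 := hG.lenSq_pos (sideDir_ne_zero (k + 2))
  exact ((hG.smooth_cornerProd k).div (((hG.smooth_lenSq _).sqrt p1).mul
    ((hG.smooth_lenSq _).sqrt p2)) fun q hq => mul_ne_zero (Real.sqrt_pos.2 (p1 q hq)).ne'
      (Real.sqrt_pos.2 (p2 q hq)).ne').neg

theorem interiorAngle_eq (k : Fin 3) {t : ℝ} (ht : t ∈ Icc (0 : ℝ) 1) :
    interiorAngle (G t) k = Real.arccos (cornerCos G k (t, refVertex k)) := by
  have hq : (t, refVertex k) ∈ prism := ⟨ht, refVertex_mem k⟩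
  have s1 := hG.sideSpeed_eq k hq
  have s2 := hG.sideSpeed_eq (k + 2) hq
  have hm := hG.matrix_eq hq
  rw [interiorAngle, unitTangent, unitTangent, s1, s2, hm, form_eq]
  simp only [cornerCos, cornerProd, Pi.add_apply, Pi.smul_apply, Pi.neg_apply, Pi.div_apply,
    Pi.mul_apply, smul_eq_mul, Matrix.of_apply, Matrix.cons_val_zero, Matrix.cons_val_one]
  congr 1
  ring

/-- Lagrange's identity; two sides of the reference triangle span a parallelogram of coordinate area
1. Positivity keeps the angle off 0 and π, where `arccos` is not differentiable. -/
theorem one_sub_cornerCos_sq (k : Fin 3) {q : ℝ × Coord} (hq : q ∈ prism) :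
    1 - cornerCos G k q ^ 2
      = metDet G q / (lenSq G (sideDir k) q * lenSq G (sideDir (k + 2)) q) := by
  have p1 := hG.lenSq_pos (sideDir_ne_zero k) q hq
  have p2 := hG.lenSq_pos (sideDir_ne_zero (k + 2)) q hq
  simp only [cornerCos, Pi.neg_apply, Pi.div_apply, Pi.mul_apply, neg_sq, div_pow, mul_pow,
    Real.sq_sqrt p1.le, Real.sq_sqrt p2.le]
  have n1 := p1.ne'
  have n2 := p2.ne'
  field_simp
  simp only [lenSq, cornerProd, metDet, Pi.add_apply, Pi.smul_apply, Pi.sub_apply, Pi.mul_apply,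
    smul_eq_mul]
  fin_cases k <;> simp [sideDir_eq] <;> ring

theorem time_cornerCos (k : Fin 3) {q : ℝ × Coord} (hq : q ∈ prism) :
    dirD eTime (cornerCos G k) q = -(dirD eTime (cornerProd G k) q
        - cornerProd G k q * (dirD eTime (lenSq G (sideDir k)) q / (2 * lenSq G (sideDir k) q)
          + dirD eTime (lenSq G (sideDir (k + 2))) q / (2 * lenSq G (sideDir (k + 2)) q)))
      / (√(lenSq G (sideDir k) q) * √(lenSq G (sideDir (k + 2)) q)) := by
  have p1 := hG.lenSq_pos (sideDir_ne_zero k)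
  have p2 := hG.lenSq_pos (sideDir_ne_zero (k + 2))
  have r1 := (Real.sqrt_pos.2 (p1 q hq)).ne'
  have r2 := (Real.sqrt_pos.2 (p2 q hq)).ne'
  have h1 := (hG.smooth_lenSq (sideDir k)).sqrt p1
  have h2 := (hG.smooth_lenSq (sideDir (k + 2))).sqrt p2
  have n1 := (p1 q hq).ne'
  have n2 := (p2 q hq).ne'
  rw [cornerCos, dirD_neg _ hq, dirD_div _ (hG.smooth_cornerProd k) (h1.mul h2)
    (fun q hq => mul_ne_zero (Real.sqrt_pos.2 (p1 q hq)).ne' (Real.sqrt_pos.2 (p2 q hq)).ne') hq,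
    dirD_mul _ h1 h2 hq, dirD_sqrt _ (hG.smooth_lenSq _) p1 hq,
    dirD_sqrt _ (hG.smooth_lenSq _) p2 hq, Pi.mul_apply]
  field_simp
  ring

/-- The angle runs from side k to the reversed side k + 2, and each direction turns at its own rate.
Reversing a side is harmless because `rotRate` is even in the direction. -/
theorem hasDerivWithinAt_interiorAngle (k : Fin 3) {t : ℝ} (ht : t ∈ Icc (0 : ℝ) 1) :
    HasDerivWithinAt (fun s => interiorAngle (G s) k)
      (rotRate G (sideDir (k + 2)) (t, refVertex k) - rotRate G (sideDir k) (t, refVertex k))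
      (Icc 0 1) t := by
  have hq : (t, refVertex k) ∈ prism := ⟨ht, refVertex_mem k⟩
  set q : ℝ × Coord := (t, refVertex k) with hqdef
  have p1 := hG.lenSq_pos (sideDir_ne_zero k) q hq
  have p2 := hG.lenSq_pos (sideDir_ne_zero (k + 2)) q hq
  have pD := hG.metDet_pos q hq
  have hsq := hG.one_sub_cornerCos_sq k hq
  have hpos : 0 < 1 - cornerCos G k q ^ 2 := by rw [hsq]; positivity
  have hc := (hG.smooth_cornerCos k).hasDerivWithinAt_time hq
  have harc := Real.hasDerivAt_arccos (x := cornerCos G k q) (fun h => by simp [h] at hpos)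
    (fun h => by simp [h] at hpos)
  have h := harc.comp_hasDerivWithinAt t hc
  refine (h.congr_of_mem (fun s hs => hG.interiorAngle_eq k hs) ht).congr_deriv ?_
  have r1 := (Real.sqrt_pos.2 p1).ne'
  have r2 := (Real.sqrt_pos.2 p2).ne'
  have r3 : metRoot G q ≠ 0 := (Real.sqrt_pos.2 pD).ne'
  have r3' : metRoot G q ^ 2 = metDet G q := Real.sq_sqrt pD.le
  have hB : dirD eTime (cornerProd G k) q
      = (sideDir k 0 * sideDir (k + 2) 0) * dirD eTime (metE G) q
        + (sideDir k 0 * sideDir (k + 2) 1 + sideDir k 1 * sideDir (k + 2) 0)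
          * dirD eTime (metF G) q
        + (sideDir k 1 * sideDir (k + 2) 1) * dirD eTime (metH G) q := by
    have hE := hG.smooth_metE
    have hF := hG.smooth_metF
    have hH := hG.smooth_metH
    rw [cornerProd, dirD_add _ ((hE.smul _).add (hF.smul _)) (hH.smul _) hq,
      dirD_add _ (hE.smul _) (hF.smul _) hq, dirD_smul _ _ hE hq, dirD_smul _ _ hF hq,
      dirD_smul _ _ hH hq]
  have hroot : √(1 - cornerCos G k q ^ 2) = metRoot G q
      / (√(lenSq G (sideDir k) q) * √(lenSq G (sideDir (k + 2)) q)) := by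
    rw [hsq, Real.sqrt_div pD.le, Real.sqrt_mul p1.le]
    rfl
  have n1 := p1.ne'
  have n2 := p2.ne'
  have nD := pD.ne'
  rw [hroot, hG.time_cornerCos k hq, hB, hG.dirD_lenSq _ _ hq, hG.dirD_lenSq _ _ hq]
  simp only [rotRate, Pi.smul_apply, Pi.div_apply, Pi.mul_apply, smul_eq_mul]
  field_simp
  rw [r3']
  simp only [lenSq, cornerProd, metDet, rotNum, Pi.add_apply, Pi.smul_apply, Pi.sub_apply,
    Pi.mul_apply, smul_eq_mul]
  clear_value q
  fin_cases k <;> simp [sideDir_eq] <;> ring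

/-! ### Contractions with the variation of the metric -/

theorem tensorInner_opS (A : Matrix (Fin 2) (Fin 2) ℝ) {q : ℝ × Coord} (hq : q ∈ prism) :
    tensorInner (G q.1 q.2) (opS (G q.1 q.2) !![dirD eTime (metE G) q, dirD eTime (metF G) q;
        dirD eTime (metF G) q, dirD eTime (metH G) q]) A * areaDensity (G q.1) q.2
      = 2 * (stress G 0 0 q * A 0 0 + stress G 0 1 q * A 0 1 + stress G 1 0 q * A 1 0
        + stress G 1 1 q * A 1 1) := by
  have hD := hG.metDet_ne q hq
  have hDd : metDet G q = metE G q * metH G q - metF G q * metF G q := rfl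
  rw [hG.areaDensity_eq hq]
  simp only [tensorInner, opS, metricTrace, hG.matrix_inv hq]
  simp only [hG.matrix_eq hq, Fin.sum_univ_two, stress, Pi.smul_apply, Pi.mul_apply, Pi.div_apply, smul_eq_mul, Matrix.of_apply,
    Matrix.cons_val_zero, Matrix.cons_val_one, Matrix.sub_apply, Matrix.smul_apply]
  field_simp
  rw [hDd]
  ring

/-- Contracting `stress` with the conormal and l gives ½ (𝕊σ)(n, ·) ds applied to l, with a normal
and a tangential part. As (𝕊σ)(n, τ) = σ(n, τ), the `rotRate` term removes exactly the tangential
part. -/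
theorem form_opS_unitNormal (k : Fin 3) (l : Coord →L[ℝ] ℝ) {q : ℝ × Coord} (hq : q ∈ prism) :
    form (opS (G q.1 q.2) !![dirD eTime (metE G) q, dirD eTime (metF G) q;
        dirD eTime (metF G) q, dirD eTime (metH G) q]) (unitNormal (G q.1 q.2) k)
        (unitNormal (G q.1 q.2) k) * l (unitNormal (G q.1 q.2) k) * sideSpeed (G q.1 q.2) k
      = 2 * (sideConormal k 0 * (stress G 0 0 q * l (Pi.single 0 1)
            + stress G 0 1 q * l (Pi.single 1 1))
          + sideConormal k 1 * (stress G 1 0 q * l (Pi.single 0 1)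
            + stress G 1 1 q * l (Pi.single 1 1))
          + rotRate G (sideDir k) q * (sideDir k 0 * l (Pi.single 0 1)
            + sideDir k 1 * l (Pi.single 1 1))) := by
  have hL := hG.lenSq_pos (sideDir_ne_zero k) q hq
  have hD := hG.metDet_ne q hq
  have hr : metRoot G q ^ 3 = metRoot G q * metDet G q := by
    rw [pow_succ', metRoot, Real.sq_sqrt (hG.metDet_pos q hq).le]
  have hs : √(lenSq G (sideDir k) q) ≠ 0 := (Real.sqrt_pos.2 hL).ne'
  have hs2 : √(lenSq G (sideDir k) q) ^ 2 = lenSq G (sideDir k) q := Real.sq_sqrt hL.le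
  have hL' := hL.ne'
  have hDd : metDet G q = metE G q * metH G q - metF G q * metF G q := rfl
  have hLd : lenSq G (sideDir k) q = sideDir k 0 ^ 2 * metE G q
    + 2 * (sideDir k 0 * sideDir k 1) * metF G q + sideDir k 1 ^ 2 * metH G q := rfl
  have hl : ∀ c a b : ℝ, l (c • ![a, b]) = c * (a * l (Pi.single 0 1) + b * l (Pi.single 1 1)) := by
    intro c a b
    have : (![a, b] : Coord) = a • Pi.single 0 1 + b • Pi.single 1 1 := by
      ext i; fin_cases i <;> simp
    rw [map_smul, this, map_add, map_smul, map_smul]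
    simp
  rw [hG.unitNormal_eq k hq, hG.sideSpeed_eq k hq, hl, form_eq]
  simp only [opS, metricTrace, hG.matrix_inv hq]
  simp only [hG.matrix_eq hq, Fin.sum_univ_two, stress, rotRate, rotNum, Pi.smul_apply, Pi.mul_apply, Pi.div_apply, smul_eq_mul,
    Matrix.of_apply, Matrix.cons_val_zero, Matrix.cons_val_one, Matrix.sub_apply,
    Matrix.smul_apply, Pi.add_apply, Pi.sub_apply, sideConormal]
  field_simp
  rw [hs2, hr]
  field_simp
  rw [hLd, hDd]
  ring

end MetricFamily

/-! ### The variation formula on one triangle -/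

/-- The contribution of one triangle to the distributional curvature: `∫ w K dA` over the triangle,
plus `∫ w k ds` over its sides, minus the interior angles weighted by `w`. -/
def triangleCurv (G : MatField) (w : Coord → ℝ) : ℝ :=
  (∫ x in refTriangle, w x * gaussCurv G x * areaDensity G x)
    + (∑ k, ∫ s in (0 : ℝ)..1, w (sidePt k s) * geodCurv G k (sidePt k s) *
        sideSpeed (G (sidePt k s)) k)
    - ∑ k, w (refVertex k) * interiorAngle G k

/-- The contribution of one triangle to the bilinear form `b_h`. -/
def triangleForm (G σ : MatField) (w : Coord → ℝ) : ℝ :=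
  (∫ x in refTriangle,
      tensorInner (G x) (opS (G x) (σ x)) (hessian G w x) * areaDensity G x)
    - ∑ k, ∫ s in (0 : ℝ)..1,
        form (opS (G (sidePt k s)) (σ (sidePt k s))) (unitNormal (G (sidePt k s)) k)
            (unitNormal (G (sidePt k s)) k) *
          fderivWithin ℝ w refTriangle (sidePt k s) (unitNormal (G (sidePt k s)) k) *
          sideSpeed (G (sidePt k s)) k

/-! ### Calculus with a C² test function on the triangle. -/

theorem partialD_mul {f g : Coord → ℝ} (hf : ContDiffOn ℝ 1 f refTriangle)
    (hg : ContDiffOn ℝ 1 g refTriangle) (a : Fin 2) {x : Coord} (hx : x ∈ refTriangle) :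
    partialD a (fun y => f y * g y) x = f x * partialD a g x + g x * partialD a f x := by
  rw [partialD, fderivWithin_fun_mul (uniqueDiffOn_refTriangle x hx)
    (hf.differentiableOn one_ne_zero x hx) (hg.differentiableOn one_ne_zero x hx)]
  rfl

theorem partialD_add {f g : Coord → ℝ} (hf : ContDiffOn ℝ 1 f refTriangle)
    (hg : ContDiffOn ℝ 1 g refTriangle) (a : Fin 2) {x : Coord} (hx : x ∈ refTriangle) :
    partialD a (fun y => f y + g y) x = partialD a f x + partialD a g x := by
  rw [partialD, fderivWithin_fun_add (uniqueDiffOn_refTriangle x hx)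
    (hf.differentiableOn one_ne_zero x hx) (hg.differentiableOn one_ne_zero x hx)]
  rfl

theorem partialD_sub {f g : Coord → ℝ} (hf : ContDiffOn ℝ 1 f refTriangle)
    (hg : ContDiffOn ℝ 1 g refTriangle) (a : Fin 2) {x : Coord} (hx : x ∈ refTriangle) :
    partialD a (fun y => f y - g y) x = partialD a f x - partialD a g x := by
  rw [partialD, fderivWithin_fun_sub (uniqueDiffOn_refTriangle x hx)
    (hf.differentiableOn one_ne_zero x hx) (hg.differentiableOn one_ne_zero x hx)]
  rfl

theorem contDiffOn_partialD {w : Coord → ℝ} (hw : ContDiffOn ℝ 2 w refTriangle) (a : Fin 2) :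
    ContDiffOn ℝ 1 (partialD a w) refTriangle :=
  ContDiffOn.clm_apply (hw.fderivWithin uniqueDiffOn_refTriangle
    (by rw [one_add_one_eq_two])) contDiffOn_const

theorem hasDerivWithinAt_comp_sidePt {w : Coord → ℝ} (hw : ContDiffOn ℝ 1 w refTriangle)
    (k : Fin 3) {s : ℝ} (hs : s ∈ Icc (0 : ℝ) 1) :
    HasDerivWithinAt (fun s => w (sidePt k s))
      (sideDir k 0 * partialD 0 w (sidePt k s) + sideDir k 1 * partialD 1 w (sidePt k s))
      (Icc 0 1) s := by
  have h := (hw.differentiableOn one_ne_zero _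
    (sidePt_mem k hs)).hasFDerivWithinAt.comp_hasDerivWithinAt s
    (hasDerivAt_sidePt k s).hasDerivWithinAt
    (show MapsTo (sidePt k) (Icc 0 1) refTriangle from fun _ hr => sidePt_mem k hr)
  refine h.congr_deriv ?_
  have : sideDir k = sideDir k 0 • Pi.single 0 1 + sideDir k 1 • Pi.single 1 1 := by
    ext i; fin_cases i <;> simp
  conv_lhs => rw [this]
  rw [map_add, map_smul, map_smul]
  rfl

theorem continuousOn_comp_sidePt {w : Coord → ℝ} (hw : ContinuousOn w refTriangle) (k : Fin 3) :
    ContinuousOn (fun s => w (sidePt k s)) (Icc 0 1) :=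
  hw.comp (continuous_sidePt k).continuousOn fun _ hs => sidePt_mem k hs

/-- The vector field whose divergence links the two sides of the variation formula. -/
def linkField (G : ℝ → MatField) (w : Coord → ℝ) (t : ℝ) (a : Fin 2) (x : Coord) : ℝ :=
  w x * flux G a (t, x)
    - (stress G a 0 (t, x) * partialD 0 w x + stress G a 1 (t, x) * partialD 1 w x)

namespace MetricFamily

variable {G : ℝ → MatField} (hG : MetricFamily G)
include hG

theorem contDiffOn_linkField {w : Coord → ℝ} (hw : ContDiffOn ℝ 2 w refTriangle) {t : ℝ}
    (ht : t ∈ Icc (0 : ℝ) 1) (a : Fin 2) : ContDiffOn ℝ 1 (linkField G w t a) refTriangle :=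
  ((hw.of_le one_le_two).mul ((hG.smooth_flux a).slice (n := 1) ht)).sub
    ((((hG.smooth_stress a 0).slice (n := 1) ht).mul (contDiffOn_partialD hw 0)).add
      (((hG.smooth_stress a 1).slice (n := 1) ht).mul (contDiffOn_partialD hw 1)))

theorem partialD_linkField {w : Coord → ℝ} (hw : ContDiffOn ℝ 2 w refTriangle) {t : ℝ}
    (ht : t ∈ Icc (0 : ℝ) 1) (a b : Fin 2) {x : Coord} (hx : x ∈ refTriangle) :
    partialD b (linkField G w t a) x
      = w x * dirD (eSpace b) (flux G a) (t, x) + flux G a (t, x) * partialD b w x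
        - (stress G a 0 (t, x) * partialD b (partialD 0 w) x
            + partialD 0 w x * dirD (eSpace b) (stress G a 0) (t, x)
          + (stress G a 1 (t, x) * partialD b (partialD 1 w) x
            + partialD 1 w x * dirD (eSpace b) (stress G a 1) (t, x))) := by
  have hw1 : ContDiffOn ℝ 1 w refTriangle := hw.of_le one_le_two
  have hJ := (hG.smooth_flux a).slice (n := 1) ht
  have h0 := (hG.smooth_stress a 0).slice (n := 1) ht
  have h1 := (hG.smooth_stress a 1).slice (n := 1) ht
  have hp0 := contDiffOn_partialD hw 0
  have hp1 := contDiffOn_partialD hw 1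
  have hq : (t, x) ∈ prism := ⟨ht, hx⟩
  have e : linkField G w t a = fun x => w x * flux G a (t, x)
    - (stress G a 0 (t, x) * partialD 0 w x + stress G a 1 (t, x) * partialD 1 w x) := rfl
  rw [e, partialD_sub (hw1.mul hJ) ((h0.mul hp0).add (h1.mul hp1)) b hx,
    partialD_mul hw1 hJ b hx, partialD_add (h0.mul hp0) (h1.mul hp1) b hx,
    partialD_mul h0 hp0 b hx, partialD_mul h1 hp1 b hx]
  rw [show partialD b (fun x => flux G a (t, x)) x = dirD (eSpace b) (flux G a) (t, x) from
      (hG.smooth_flux a).partialD_slice b hq,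
    show partialD b (fun x => stress G a 0 (t, x)) x = dirD (eSpace b) (stress G a 0) (t, x) from
      (hG.smooth_stress a 0).partialD_slice b hq,
    show partialD b (fun x => stress G a 1 (t, x)) x = dirD (eSpace b) (stress G a 1) (t, x) from
      (hG.smooth_stress a 1).partialD_slice b hq]

/-- The integration by parts identity in the interior. -/
theorem divergence_linkField {w : Coord → ℝ} (hw : ContDiffOn ℝ 2 w refTriangle) {t : ℝ}
    (ht : t ∈ Icc (0 : ℝ) 1) {x : Coord} (hx : x ∈ refTriangle) :
    partialD 0 (linkField G w t 0) x + partialD 1 (linkField G w t 1) x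
      = w x * (dirD (eSpace 0) (flux G 0) (t, x) + dirD (eSpace 1) (flux G 1) (t, x))
        - (stress G 0 0 (t, x) * hessian (G t) w x 0 0 + stress G 0 1 (t, x) * hessian (G t) w x 0 1
          + stress G 1 0 (t, x) * hessian (G t) w x 1 0
          + stress G 1 1 (t, x) * hessian (G t) w x 1 1) := by
  rw [hG.partialD_linkField hw ht 0 0 hx, hG.partialD_linkField hw ht 1 1 hx]
  have hf : ∀ a, flux G a (t, x) = dirD (eSpace 0) (stress G a 0) (t, x)
      + dirD (eSpace 1) (stress G a 1) (t, x)
      + (gam G a 0 0 (t, x) * stress G 0 0 (t, x) + gam G a 0 1 (t, x) * stress G 0 1 (t, x)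
        + gam G a 1 0 (t, x) * stress G 1 0 (t, x) + gam G a 1 1 (t, x) * stress G 1 1 (t, x)) :=
    fun a => rfl
  have hh : ∀ a b, hessian (G t) w x a b = partialD a (partialD b w) x
      - (gam G 0 a b (t, x) * partialD 0 w x + gam G 1 a b (t, x) * partialD 1 w x) := by
    intro a b
    simp only [hessian, Matrix.of_apply, Fin.sum_univ_two]
    rfl
  -- Symmetry of the stress makes the first-order terms in w cancel; the Christoffel terms of `flux`
  -- are those of the Hessian.
  have hsym : stress G 1 0 = stress G 0 1 := rfl
  rw [hf 0, hf 1, hh, hh, hh, hh, hsym]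
  ring

/-- The variation of the contribution of one triangle to the distributional curvature. -/
theorem hasDerivWithinAt_triangleCurv {w : Coord → ℝ} (hw : ContDiffOn ℝ 2 w refTriangle)
    {σ : MatField} {t : ℝ} (ht : t ∈ Icc (0 : ℝ) 1)
    (hσ : ∀ x ∈ refTriangle, σ x = !![dirD eTime (metE G) (t, x), dirD eTime (metF G) (t, x);
      dirD eTime (metF G) (t, x), dirD eTime (metH G) (t, x)]) :
    HasDerivWithinAt (fun s => triangleCurv (G s) w) (1 / 2 * triangleForm (G t) σ w)
      (Icc 0 1) t := by
  have hw1 : ContDiffOn ℝ 1 w refTriangle := hw.of_le one_le_two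
  have hd : (![1, 0] : Coord) ≠ 0 := fun h => by simpa using congrFun h 0
  set curv : ℝ × Coord → ℝ :=
    dirD (eSpace 1) (conn G ![1, 0] 0) - dirD (eSpace 0) (conn G ![1, 0] 1) with hcurv
  have hcs : SmoothOnPrism curv :=
    ((hG.smooth_conn hd 0).deriv _).sub ((hG.smooth_conn hd 1).deriv _)
  have A := hasDerivWithinAt_integral_refTriangle hw.continuousOn hcs ht
  have B : HasDerivWithinAt
      (fun r => ∑ k, ∫ s in (0 : ℝ)..1, w (sidePt k s) * sideConn G k (r, sidePt k s))
      (∑ k, ∫ s in (0 : ℝ)..1, w (sidePt k s) * dirD eTime (sideConn G k) (t, sidePt k s))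
      (Icc 0 1) t :=
    HasDerivWithinAt.fun_sum fun k _ =>
      hasDerivWithinAt_integral_side hw.continuousOn (hG.smooth_sideConn k) k ht
  have C : HasDerivWithinAt (fun r => ∑ k, w (refVertex k) * interiorAngle (G r) k)
      (∑ k, w (refVertex k) * (rotRate G (sideDir (k + 2)) (t, refVertex k)
        - rotRate G (sideDir k) (t, refVertex k))) (Icc 0 1) t :=
    HasDerivWithinAt.fun_sum fun k _ =>
      (hG.hasDerivWithinAt_interiorAngle k ht).const_mul _
  have heq : ∀ r ∈ Icc (0 : ℝ) 1, triangleCurv (G r) w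
      = (∫ x in refTriangle, w x * curv (r, x))
        + (∑ k, ∫ s in (0 : ℝ)..1, w (sidePt k s) * sideConn G k (r, sidePt k s))
        - ∑ k, w (refVertex k) * interiorAngle (G r) k := by
    intro r hr
    rw [triangleCurv]
    congr 2
    · refine setIntegral_congr_fun measurableSet_refTriangle fun x hx => ?_
      have := hG.gaussCurv_mul_areaDensity (q := (r, x)) ⟨hr, hx⟩
      simp only at this ⊢
      rw [mul_assoc, this]
      rfl
    · refine Finset.sum_congr rfl fun k _ => intervalIntegral.integral_congr fun s hs => ?_
      rw [uIcc_of_le zero_le_one] at hs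
      have := hG.geodCurv_mul_sideSpeed k (q := (r, sidePt k s)) ⟨hr, sidePt_mem k hs⟩
      simp only at this ⊢
      rw [mul_assoc, this]
  refine (((A.add B).sub C).congr_of_mem heq ht).congr_deriv ?_
  -- the interior term
  have hlink := fun a => hG.contDiffOn_linkField hw ht a
  have hdiv : ContinuousOn (fun x => partialD 0 (linkField G w t 0) x
      + partialD 1 (linkField G w t 1) x) refTriangle :=
    (continuousOn_partialD (hlink 0) 0).add
      (continuousOn_partialD (hlink 1) 1)
  have hcont : ContinuousOn (fun x => w x * dirD eTime curv (t, x)) refTriangle :=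
    hw.continuousOn.mul ((hcs.deriv eTime).slice (n := 0) ht).continuousOn
  have hT : 1 / 2 * ∫ x in refTriangle, tensorInner (G t x) (opS (G t x) (σ x))
        (hessian (G t) w x) * areaDensity (G t) x
      = (∫ x in refTriangle, w x * dirD eTime curv (t, x))
        - ∫ x in refTriangle, (partialD 0 (linkField G w t 0) x
          + partialD 1 (linkField G w t 1) x) := by
    rw [← integral_sub (hcont.integrableOn_compact isCompact_refTriangle)
      (hdiv.integrableOn_compact isCompact_refTriangle), ← integral_const_mul]
    refine setIntegral_congr_fun measurableSet_refTriangle fun x hx => ?_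
    have hq : (t, x) ∈ prism := ⟨ht, hx⟩
    have h1 := hG.tensorInner_opS (hessian (G t) w x) hq
    simp only at h1 ⊢
    rw [hσ x hx, h1, hG.divergence_linkField hw ht hx, hcurv, hG.time_curvature hq]
    ring
  -- the terms on the sides
  have hside : ∀ k, (∫ s in (0 : ℝ)..1,
        (linkField G w t 0 (sidePt k s) * sideConormal k 0
          + linkField G w t 1 (sidePt k s) * sideConormal k 1))
      + (∫ s in (0 : ℝ)..1, w (sidePt k s) * dirD eTime (sideConn G k) (t, sidePt k s))
      = w (refVertex (k + 1)) * rotRate G (sideDir k) (t, refVertex (k + 1))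
        - w (refVertex k) * rotRate G (sideDir k) (t, refVertex k)
        - 1 / 2 * ∫ s in (0 : ℝ)..1,
          form (opS (G t (sidePt k s)) (σ (sidePt k s))) (unitNormal (G t (sidePt k s)) k)
            (unitNormal (G t (sidePt k s)) k) *
          fderivWithin ℝ w refTriangle (sidePt k s) (unitNormal (G t (sidePt k s)) k) *
          sideSpeed (G t (sidePt k s)) k := by
    intro k
    have hrs := hG.smooth_rotRate (sideDir_ne_zero k)
    set w' : ℝ → ℝ := fun s => sideDir k 0 * partialD 0 w (sidePt k s)
      + sideDir k 1 * partialD 1 w (sidePt k s) with hw'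
    set ρ : ℝ → ℝ := fun s => rotRate G (sideDir k) (t, sidePt k s) with hρ
    set ρ' : ℝ → ℝ := fun s => sideDir k 0 * dirD (eSpace 0) (rotRate G (sideDir k)) (t, sidePt k s)
      + sideDir k 1 * dirD (eSpace 1) (rotRate G (sideDir k)) (t, sidePt k s) with hρ'
    have cw : ContinuousOn (fun s => w (sidePt k s)) (Icc 0 1) :=
      continuousOn_comp_sidePt hw.continuousOn k
    have slice_cont : ∀ {f : ℝ × Coord → ℝ}, SmoothOnPrism f →
        ContinuousOn (fun s => f (t, sidePt k s)) (Icc 0 1) := fun hf =>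
      continuousOn_comp_sidePt (hf.slice (n := 0) ht).continuousOn k
    have cw' : ContinuousOn w' (Icc 0 1) :=
      (continuousOn_const.mul (continuousOn_comp_sidePt
        (continuousOn_partialD hw1 0) k)).add (continuousOn_const.mul
        (continuousOn_comp_sidePt (continuousOn_partialD hw1 1) k))
    have cρ : ContinuousOn ρ (Icc 0 1) := slice_cont hrs
    have cρ' : ContinuousOn ρ' (Icc 0 1) :=
      (continuousOn_const.mul (slice_cont (hrs.deriv _))).add
        (continuousOn_const.mul (slice_cont (hrs.deriv _)))
    -- Integration by parts along the side; the endpoint values are kept for the angle terms.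
    have parts : ∫ s in (0 : ℝ)..1, (w' s * ρ s + w (sidePt k s) * ρ' s)
        = w (sidePt k 1) * ρ 1 - w (sidePt k 0) * ρ 0 := by
      refine intervalIntegral.integral_eq_sub_of_hasDerivAt_of_le zero_le_one (cw.mul cρ)
        (fun s hs => ?_) (((cw'.mul cρ).add (cw.mul cρ')).intervalIntegrable_of_Icc zero_le_one)
      have hs' := Ioo_subset_Icc_self hs
      exact ((hasDerivWithinAt_comp_sidePt hw1 k hs').mul
        (hrs.hasDerivWithinAt_side k ht hs')).hasDerivAt (Icc_mem_nhds hs.1 hs.2)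
    have i1 : IntervalIntegrable (fun s => linkField G w t 0 (sidePt k s) * sideConormal k 0
          + linkField G w t 1 (sidePt k s) * sideConormal k 1) volume 0 1 :=
      (((continuousOn_comp_sidePt (hlink 0).continuousOn k).mul continuousOn_const).add
        ((continuousOn_comp_sidePt (hlink 1).continuousOn k).mul
          continuousOn_const)).intervalIntegrable_of_Icc zero_le_one
    have i2 : IntervalIntegrable (fun s => w (sidePt k s)
        * dirD eTime (sideConn G k) (t, sidePt k s)) volume 0 1 :=
      (cw.mul (slice_cont ((hG.smooth_sideConn k).deriv _))).intervalIntegrable_of_Icc zero_le_one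
    have i3 : IntervalIntegrable (fun s => w' s * ρ s + w (sidePt k s) * ρ' s) volume 0 1 :=
      ((cw'.mul cρ).add (cw.mul cρ')).intervalIntegrable_of_Icc zero_le_one
    have e1 : w (refVertex (k + 1)) * rotRate G (sideDir k) (t, refVertex (k + 1))
        - w (refVertex k) * rotRate G (sideDir k) (t, refVertex k)
        = w (sidePt k 1) * ρ 1 - w (sidePt k 0) * ρ 0 := by
      simp only [hρ, sidePt_one, sidePt_zero]
    -- With all integrals collected, the claim becomes a pointwise identity of integrands.
    rw [e1, ← parts, ← intervalIntegral.integral_add i1 i2, eq_sub_iff_add_eq', ← eq_sub_iff_add_eq,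
      ← intervalIntegral.integral_sub i3 (i1.add i2), ← intervalIntegral.integral_const_mul]
    refine intervalIntegral.integral_congr fun s hs => ?_
    rw [uIcc_of_le zero_le_one] at hs
    have hx := sidePt_mem k hs
    have hq : (t, sidePt k s) ∈ prism := ⟨ht, hx⟩
    have h1 := hG.form_opS_unitNormal k (fderivWithin ℝ w refTriangle (sidePt k s)) hq
    have h2 := hG.time_sideConn k hq
    simp only at h1 ⊢
    rw [hσ _ hx, h1, h2]
    simp only [hw', hρ, hρ', linkField, sideConormal, partialD, Matrix.cons_val_zero,
      Matrix.cons_val_one]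
    ring
  have hdivergence := integral_divergence_refTriangle hlink
  rw [triangleForm, mul_sub, hT, hdivergence]
  have s0 := hside 0
  have s1 := hside 1
  have s2 := hside 2
  simp only [Fin.sum_univ_three] at *
  -- Cyclic bookkeeping: the final endpoint value of side k meets the angle at vertex k + 1, whose
  -- incoming side is (k + 1) + 2 = k.
  have f1 : (0 : Fin 3) + 1 = 1 := rfl
  have f2 : (1 : Fin 3) + 1 = 2 := rfl
  have f3 : (2 : Fin 3) + 1 = 0 := rfl
  have f4 : (0 : Fin 3) + 2 = 2 := rfl
  have f5 : (1 : Fin 3) + 2 = 0 := rfl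
  have f6 : (2 : Fin 3) + 2 = 1 := rfl
  rw [f1] at s0
  rw [f2] at s1
  rw [f3] at s2
  rw [f4, f5, f6]
  linear_combination s0 + s1 + s2

end MetricFamily

/-! ### Assembling the triangles -/

namespace Triangulation

variable {M : Type*} [TopologicalSpace M] [ChartedSpace (EuclideanQuadrant 2) M]
  [IsManifold modelI ∞ M] {o : SurfaceOrientation M} {ι : Type*} [Fintype ι]
  {𝒯 : Triangulation o ι}

/-- Each pair (i, k) lies over exactly one edge, so regrouping needs no count of the triangles at an
edge. -/
theorem sum_edges_edgeSum (X : ι → Fin 3 → ℝ) :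
    ∑ e ∈ 𝒯.edges, 𝒯.edgeSum X e = ∑ i, ∑ k, X i k := by
  classical
  simp only [edgeSum]
  rw [Finset.sum_comm]
  refine Finset.sum_congr rfl fun i _ => ?_
  rw [Finset.sum_comm]
  refine Finset.sum_congr rfl fun k _ => ?_
  rw [Finset.sum_ite_eq, if_pos]
  exact Finset.mem_image_of_mem (fun q : ι × Fin 3 => 𝒯.edge q.1 q.2) (Finset.mem_univ (i, k))

theorem sum_vertices_vertexSum (X : ι → Fin 3 → ℝ) (v : M → ℝ) :
    ∑ p ∈ 𝒯.vertices, v p * 𝒯.vertexSum X p = ∑ i, ∑ k, v (𝒯.vertex i k) * X i k := by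
  classical
  simp only [vertexSum, Finset.mul_sum, mul_ite, mul_zero]
  rw [Finset.sum_comm]
  refine Finset.sum_congr rfl fun i _ => ?_
  rw [Finset.sum_comm]
  refine Finset.sum_congr rfl fun k _ => ?_
  rw [Finset.sum_ite_eq, if_pos]
  exact Finset.mem_image_of_mem (fun q : ι × Fin 3 => 𝒯.vertex q.1 q.2) (Finset.mem_univ (i, k))

theorem edgeSum_sub (X Y : ι → Fin 3 → ℝ) (e : Set M) :
    𝒯.edgeSum (fun i k => X i k - Y i k) e = 𝒯.edgeSum X e - 𝒯.edgeSum Y e := by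
  simp only [edgeSum, ← Finset.sum_sub_distrib]
  refine Finset.sum_congr rfl fun i _ => Finset.sum_congr rfl fun k _ => ?_
  split_ifs <;> simp

/-- The part of `connDist - curvDist` that does not depend on the metric. -/
def metricFreePart (𝒯 : Triangulation o ι) (μ : ι → Fin 3 → ℝ → ℝ) (v : M → ℝ) : ℝ :=
  open Classical in
  (∑ e ∈ 𝒯.edges with e ⊆ ModelWithCorners.boundary (I := modelI) M,
      𝒯.edgeSum (fun i k =>
        ∫ s in (0 : ℝ)..1, v (𝒯.param i (sidePt k s)) * derivWithin (μ i k) (Icc 0 1) s) e)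
    - (∑ p ∈ 𝒯.vertices with p ∈ ModelWithCorners.boundary (I := modelI) M,
        v p * (Real.pi - 𝒯.angleJump μ p))
    - ∑ p ∈ 𝒯.vertices with p ∉ ModelWithCorners.boundary (I := modelI) M,
        v p * (2 * Real.pi)

/-- The metric enters `connDist - curvDist` through a sum over the triangles. -/
theorem connDist_sub_curvDist (g : 𝒯.ReggeMetric) (μ : ι → Fin 3 → ℝ → ℝ) (v : M → ℝ) :
    connDist g μ v - curvDist g v
      = 𝒯.metricFreePart μ v - ∑ i, triangleCurv (g.mat i) (v ∘ 𝒯.param i) := by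
  classical
  have he := sum_edges_edgeSum (𝒯 := 𝒯) (curvIntegral g v)
  have hp := sum_vertices_vertexSum (𝒯 := 𝒯) (fun i k => interiorAngle (g.mat i) k) v
  -- Curvature integrals and angles have the same sign on and off the boundary, so the two filtered
  -- sums recombine into sums over all edges and all vertices.
  rw [← Finset.sum_filter_add_sum_filter_not 𝒯.edges
    (fun e => e ⊆ ModelWithCorners.boundary (I := modelI) M)] at he
  rw [← Finset.sum_filter_add_sum_filter_not 𝒯.vertices
    (fun p => p ∈ ModelWithCorners.boundary (I := modelI) M)] at hp
  have hT : ∑ i, triangleCurv (g.mat i) (v ∘ 𝒯.param i)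
      = (∑ i, ∫ x in refTriangle,
          v (𝒯.param i x) * gaussCurv (g.mat i) x * areaDensity (g.mat i) x)
        + (∑ i, ∑ k, curvIntegral g v i k)
        - ∑ i, ∑ k, v (𝒯.vertex i k) * interiorAngle (g.mat i) k := by
    rw [← Finset.sum_add_distrib, ← Finset.sum_sub_distrib]
    rfl
  rw [hT, ← he, ← hp]
  simp only [connDist, curvDist, metricFreePart, edgeSum_sub, angleSum, mul_sub,
    Finset.sum_sub_distrib]
  ring

theorem bForm_eq_sum (g : 𝒯.ReggeMetric) (σ : PiecewiseForm M ι) (v : M → ℝ) :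
    bForm g σ v = ∑ i, triangleForm (g.mat i) (𝒯.matrixOf σ i) (v ∘ 𝒯.param i) := by
  rw [bForm, sum_edges_edgeSum, ← Finset.sum_sub_distrib]
  rfl

omit [IsManifold modelI ∞ M] in
theorem tangentDet_smul_sub_smul (x : M) (u w : TangentSpace modelI x) (a b : ℝ) :
    tangentDet x u (a • w - b • u) = a * tangentDet x u w := by
  simp only [tangentDet]
  have h : ∀ i : Fin 2, (show EuclideanSpace ℝ (Fin 2) from (a • w - b • u)) i
      = a * (show EuclideanSpace ℝ (Fin 2) from w) i
        - b * (show EuclideanSpace ℝ (Fin 2) from u) i := fun i => rfl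
  have h0 := h 0
  have h1 := h 1
  linear_combination (show EuclideanSpace ℝ (Fin 2) from u) 0 * h1
    - (show EuclideanSpace ℝ (Fin 2) from u) 1 * h0

omit [IsManifold modelI ∞ M] in
theorem tangentDet_zero_left (x : M) (w : TangentSpace modelI x) : tangentDet x 0 w = 0 := by
  have h : ∀ i : Fin 2, (show EuclideanSpace ℝ (Fin 2) from (0 : TangentSpace modelI x)) i = 0 :=
    fun i => rfl
  simp only [tangentDet]
  have h0 := h 0
  have h1 := h 1
  linear_combination (show EuclideanSpace ℝ (Fin 2) from w) 1 * h0
    - (show EuclideanSpace ℝ (Fin 2) from w) 0 * h1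

omit [IsManifold modelI ∞ M] in
theorem tangentDet_zero_right (x : M) (u : TangentSpace modelI x) : tangentDet x u 0 = 0 := by
  have h : ∀ i : Fin 2, (show EuclideanSpace ℝ (Fin 2) from (0 : TangentSpace modelI x)) i = 0 :=
    fun i => rfl
  simp only [tangentDet]
  have h0 := h 0
  have h1 := h 1
  linear_combination (show EuclideanSpace ℝ (Fin 2) from u) 0 * h1
    - (show EuclideanSpace ℝ (Fin 2) from u) 1 * h0

/-- Preservation of orientation makes the images of the coordinate vectors linearly independent, so
the matrix of a positive form in them is positive definite. -/
theorem metricFamily_mat {g : ℝ → 𝒯.ReggeMetric} (hg : SmoothFamily g) (i : ι) :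
    MetricFamily fun t => (g t).mat i where
  smooth a b := hg i a b
  symm q hq := (g q.1).symm i _ (mem_image_of_mem _ hq.2) _ _
  pos q hq := by
    refine (g q.1).pos i _ (mem_image_of_mem _ hq.2) _ fun h => ?_
    have ho := 𝒯.orientation_preserving i q.2 hq.2
    rw [h, tangentDet_zero_left, mul_zero] at ho
    exact lt_irrefl _ ho
  det_pos q hq := by
    have hm := mem_image_of_mem (𝒯.param i) hq.2
    have ho := 𝒯.orientation_preserving i q.2 hq.2
    set u := diffMap (𝒯.param i) q.2 (Pi.single 0 1 : Coord) with hu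
    set w := diffMap (𝒯.param i) q.2 (Pi.single 1 1 : Coord) with hw
    set B := (g q.1).form i (𝒯.param i q.2) with hB
    have hdet : tangentDet (𝒯.param i q.2) u w ≠ 0 := fun h => by
      rw [h, mul_zero] at ho
      exact lt_irrefl _ ho
    have hu0 : u ≠ 0 := fun h => hdet (by rw [h, tangentDet_zero_left])
    have hE : 0 < B u u := (g q.1).pos i _ hm u hu0
    -- The multiple B(u,u) of the component of w orthogonal to u; its squared length is B(u,u) times
    -- the Gram determinant.
    have hz : B u u • w - B u w • u ≠ 0 := fun h => by
      have := tangentDet_smul_sub_smul (𝒯.param i q.2) u w (B u u) (B u w)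
      rw [h, tangentDet_zero_right] at this
      exact mul_ne_zero hE.ne' hdet this.symm
    have hpos : 0 < B (B u u • w - B u w • u) (B u u • w - B u w • u) :=
      (g q.1).pos i _ hm _ hz
    have hsymm : B w u = B u w := (g q.1).symm i _ hm w u
    have hexp : B (B u u • w - B u w • u) (B u u • w - B u w • u)
        = B u u * (B u u * B w w - B u w * B u w) := by
      simp only [map_sub, map_smul, LinearMap.sub_apply, LinearMap.smul_apply, smul_eq_mul, hsymm]
      ring
    rw [hexp] at hpos
    exact (pos_iff_pos_of_mul_pos hpos).1 hE

/-- The parametrizations do not move in time, so taking coordinates commutes with the time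
derivative. -/
theorem matrixOf_familyDeriv {g : ℝ → 𝒯.ReggeMetric} (hg : SmoothFamily g) (i : ι) {t : ℝ}
    (ht : t ∈ Icc (0 : ℝ) 1) {x : Coord} (hx : x ∈ refTriangle) :
    𝒯.matrixOf (familyDeriv g t) i x
      = !![dirD eTime (metE fun t => (g t).mat i) (t, x),
            dirD eTime (metF fun t => (g t).mat i) (t, x);
          dirD eTime (metF fun t => (g t).mat i) (t, x),
            dirD eTime (metH fun t => (g t).mat i) (t, x)] := by
  have hG := metricFamily_mat hg i
  have hq : (t, x) ∈ prism := ⟨ht, hx⟩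
  have hU : UniqueDiffWithinAt ℝ (Icc (0 : ℝ) 1) t := uniqueDiffOn_Icc zero_lt_one t ht
  have key : ∀ a b, 𝒯.matrixOf (familyDeriv g t) i x a b
      = dirD eTime (metCoef (fun t => (g t).mat i) a b) (t, x) := by
    intro a b
    rw [← dirD_congr eTime (hG.coef_eqOn a b) hq]
    exact ((hG.smooth a b).hasDerivWithinAt_time hq).derivWithin hU
  ext a b
  rw [key]
  fin_cases a <;> fin_cases b <;> rfl

end Triangulation

end Regge

end

theorem mainTheorem2 {M : Type*} [TopologicalSpace M] [T2Space M]
    [ChartedSpace (EuclideanQuadrant 2) M] [IsManifold Regge.modelI ∞ M]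
    (o : Regge.SurfaceOrientation M) {ι : Type*} [Fintype ι] (𝒯 : Regge.Triangulation o ι)
    (v : M → ℝ) (hv : 𝒯.PiecewiseC2 v)
    (g : ℝ → 𝒯.ReggeMetric) (hg : Regge.Triangulation.SmoothFamily g)
    (e₁ : ℝ → (i : ι) → (k : Fin 3) → (s : ℝ) →
      TangentSpace Regge.modelI (𝒯.param i (Regge.sidePt k s)))
    (μ : ι → Fin 3 → ℝ → ℝ)
    (hμ : ∀ i k, 𝒯.IsBoundarySide i k → ContDiffOn ℝ 1 (μ i k) (Set.Icc 0 1))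
    (he₁ : ∀ t ∈ Set.Icc (0 : ℝ) 1, Regge.Triangulation.IsBoundaryAngle (g t) (e₁ t) μ) :
    ∀ t ∈ Set.Icc (0 : ℝ) 1,
      HasDerivWithinAt
        (fun s => Regge.Triangulation.connDist (g s) μ v - Regge.Triangulation.curvDist (g s) v)
        (-(1 / 2) * Regge.Triangulation.bForm (g t)
          (Regge.Triangulation.familyDeriv g t) v)
        (Set.Icc 0 1) t := by
  intro t ht
  simp only [Regge.Triangulation.connDist_sub_curvDist, Regge.Triangulation.bForm_eq_sum]
  have h : HasDerivWithinAt
      (fun s => ∑ i, Regge.triangleCurv ((g s).mat i) (v ∘ 𝒯.param i))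
      (∑ i, 1 / 2 * Regge.triangleForm ((g t).mat i)
        (𝒯.matrixOf (Regge.Triangulation.familyDeriv g t) i) (v ∘ 𝒯.param i)) (Set.Icc 0 1) t :=
    HasDerivWithinAt.fun_sum fun i _ =>
      (Regge.Triangulation.metricFamily_mat hg i).hasDerivWithinAt_triangleCurv (hv i) ht
        fun x hx => Regge.Triangulation.matrixOf_familyDeriv hg i ht hx
  -- The metric-free part is constant because the angle μ is the same function for all times.
  refine (h.const_sub (𝒯.metricFreePart μ v)).congr_deriv ?_
  rw [← Finset.mul_sum]
  ring
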